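/- **Setting.** Let $n,k,\ell\ge 0$ and $r\ge 1$ be integers. $\mathrm{Alt}^k(V)$ is the space of alternating $k$-linear forms on a real vector space $V$ and $\mathrm{Alt}^{k,\ell}=\mathrm{Alt}^k\otimes\mathrm{Alt}^\ell$. For a nondegenerate simplex $\sigma\subset\mathbb R^n$ of dimension $m$, let $T_\sigma$ be its tangent space, $\sigma^\perp=T_\sigma^\perp\subset\mathbb R^n$, and $\mathrm{Alt}^k(\sigma)=\mathrm{Alt}^k(T_\sigma)$. Put $$\mathcal P_r^-\mathrm{Alt}^{k}(\sigma)=\mathcal P_{r-1}\mathrm{Alt}^{k}(\sigma)+\kappa\,\mathcal P_{r-1}\mathrm{Alt}^{k+1}(\sigma),\qquad \mathcal P_r^-\mathrm{Alt}^{k,\ell}(\sigma)=\mathcal P_r^-\mathrm{Alt}^{k}(\sigma)\otimes\mathrm{Alt}^\ell(\sigma),$$ where $\mathcal P_{r-1}$ denotes polynomial coefficients of degree at most $r-1$ and $\kappa$ is contraction with $x-a$ for a base point $a$ in the affine hull of $\sigma$ (the space does not depend on $a$). *Traces.* $\iota_\sigma^*$ is the pullback of forms to $\sigma$. For $0\le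 q\le\ell$, $\vartheta_{\sigma,q}^*$ maps an $\ell$-form on $\mathbb R^n$, restricted to the points of $\sigma$, to its component in $\mathrm{Alt}^q(\sigma)\otimes\mathrm{Alt}^{\ell-q}(\sigma^\perp)$; $\vartheta^*_{\sigma,q}=0$ for $q<0$ or $q>\ell$. Put $\jmath_\sigma^*=\vartheta_{\sigma,m}^*$ and $\jmath_{\sigma,[p]}^*=\vartheta_{\sigma,m}^*+\vartheta_{\sigma,m-1}^*+\dots+\vartheta_{\sigma,m-p+1}^*$, a map into the direct sum of the spaces $\mathrm{Alt}^{m-s}(\sigma)\otimes\mathrm{Alt}^{\ell-m+s}(\sigma^\perp)$, $0\le s\le p-1$ (spaces with a negative degree are zero). For a $(k,\ell)$-form, $\iota^*_\sigma\iota^*_\sigma$, $\iota_\sigma^*\jmath_\sigma^*$, $\iota_\sigma^*\jmath_{\sigma,[p]}^*$ mean $\iota^*_\sigma$ in the first index and the second operator in the second index. *Bubbles.* $\mathcal B_r^-\mathrm{Alt}^k(\sigma)$ consists of the $\omega\in\mathcal P_r^-\mathrm{Alt}^k(\sigma)$ with $\iota_F^*\omega=0$, and $\mathcal B_r^-\mathrm{Alt}^{k,\ell}(\sigma)$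 of the $\omega\in\mathcal P_r^-\mathrm{Alt}^{k,\ell}(\sigma)$ with $\iota_F^*\iota_F^*\omega=0$, for all faces $F$ of $\sigma$ of codimension one. $\langle\cdot,\cdot\rangle_\sigma$ is the $L^2(\sigma)$ inner product induced by the Euclidean metric. *Unisolvence and conformity.* Suppose that to each simplex $\sigma$ a space of test objects $b$ and functionals $\omega\mapsto D_\sigma(\omega,b)$ are attached. They are *unisolvent* for a space $V$ of forms on an $n$-simplex $K$ if for every choice of a linear functional $c_\sigma$ on the test space of each face $\sigma$ of $K$ (including $K$ itself) there is exactly one $\omega\in V$ with $D_\sigma(\omega,b)=c_\sigma(b)$ for all $\sigma$ and $b$. On a simplicial complex $\mathcal T$ in $\mathbb R^n$ the *resulting space* consists of the families $(\omega_K)_K$ of shape functions $\omega_K\in\mathcal P_r^-\mathrm{Alt}^{k,\ell}(K)$ on the $n$-simplices $K\in\mathcal T$ such that $D_\sigma(\omega_K,b)=D_\sigma(\omega_{K'},b)$ for all $b$ whenever $\sigma$ is a common face of $K$ and $K'$. A trace is *single-valued* on $\sigma$ if all $K\supseteq\sigma$ give the same trace on $\sigma$. The space is $\iota^*\iota^*$-*conforming*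 if for all its elements $\iota_\sigma^*\iota_\sigma^*$ is single-valued on every $\sigma$; $\iota^*\jmath^*$-*conforming* if $\iota_\sigma^*\jmath_\sigma^*$ is single-valued when $\dim\sigma\le\ell$ and $\iota_\sigma^*\iota_\sigma^*$ is single-valued when $\dim\sigma\ge\ell$; and $\iota^*\jmath^*_{[p]}$-*conforming* if $\iota_\sigma^*\jmath_{\sigma,[p]}^*$ is single-valued when $\dim\sigma\le\ell+p-1$ and $\iota_\sigma^*\iota_\sigma^*$ is single-valued when $\dim\sigma\ge\ell+p$. **Theorem.** For every nondegenerate $n$-simplex $K\subset\mathbb R^n$, each of the following groups of degrees of freedom, on the faces $\sigma$ of $K$, is unisolvent for $\mathcal P_r^-\mathrm{Alt}^{k,\ell}(K)$; here $m=\dim\sigma$. 1. $\langle\iota_\sigma^*\iota_\sigma^*\omega,b\rangle_\sigma$ for $b\in\mathcal B_r^-\mathrm{Alt}^{k,\ell}(\sigma)$, for all $\sigma$. The resulting space on every simplicial complex in $\mathbb R^n$ is $\iota^*\iota^*$-conforming. 2. If $k\le\ell$: $\langle\iota_\sigma^*\jmath_\sigma^*\omega,b\rangle_\sigma$ for $b\in\mathcal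 B_r^-\mathrm{Alt}^{k}(\sigma)\otimes\mathrm{Alt}^{m}(\sigma)\otimes\mathrm{Alt}^{\ell-m}(\sigma^\perp)$, for $k\le m\le\ell$ (where $\mathrm{Alt}^m(\sigma)\cong\mathbb R$ is spanned by the volume form); and $\langle\iota_\sigma^*\iota_\sigma^*\omega,b\rangle_\sigma$ for $b\in\mathcal B_r^-\mathrm{Alt}^{k,\ell}(\sigma)$, for $m>\ell$. The resulting space on every simplicial complex in $\mathbb R^n$ is $\iota^*\jmath^*$-conforming. 3. For every integer $p\ge1$ with $k\le\ell+p-1$: $\langle\iota_\sigma^*\jmath_{\sigma,[p]}^*\omega,b\rangle_\sigma$ for $b\in\bigoplus_{s=0}^{p-1}\mathcal B_r^-\mathrm{Alt}^{k}(\sigma)\otimes\bigl(\mathrm{Alt}^{m-s}(\sigma)\otimes\mathrm{Alt}^{\ell-m+s}(\sigma^\perp)\bigr)$, for $k\le m\le\ell+p-1$; and $\langle\iota_\sigma^*\iota_\sigma^*\omega,b\rangle_\sigma$ for $b\in\mathcal B_r^-\mathrm{Alt}^{k,\ell}(\sigma)$, for $m\ge\ell+p$. The resulting space on every simplicial complex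 in $\mathbb R^n$ is $\iota^*\jmath^*_{[p]}$-conforming. -/

import Mathlib

open MeasureTheory

noncomputable section

namespace FormValued

/-- Euclidean `n`-space. -/
abbrev Eucl (n : ℕ) : Type := EuclideanSpace ℝ (Fin n)

/-! ### Polynomial forms on an affine space

`X` is a real affine space with translation space `V`, and `W` is the space of values.  A `W`-valued
`k`-form on `X` is a function `X → V [⋀^Fin k]→ₗ[ℝ] W`.  With `W = V [⋀^Fin ℓ]→ₗ[ℝ] ℝ` these are the
`ℓ`-form-valued `k`-forms: `Alt^k ⊗ Alt^ℓ` is identified with the alternating `k`-linear maps with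
values in `Alt^ℓ`, `(α ⊗ β)(v₁, …, v_k)(u₁, …, u_ℓ) = α(v₁, …, v_k) β(u₁, …, u_ℓ)`. -/

section Polynomial

variable (X : Type*) {V : Type*} [AddCommGroup V] [Module ℝ V] [AddTorsor V X]
variable (W : Type*) [AddCommGroup W] [Module ℝ W]

/-- `𝒫_r Alt^k(X; W) = 𝒫_r(X) ⊗ Alt^k(V; W)`.  The polynomials of degree at most `r` on `X` are the
linear combinations of products of `r` affine functions (constants are affine functions). -/
def polyForms (r k : ℕ) : Submodule ℝ (X → V [⋀^Fin k]→ₗ[ℝ] W) :=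
  Submodule.span ℝ {ω | ∃ (f : Fin r → (X →ᵃ[ℝ] ℝ)) (η : V [⋀^Fin k]→ₗ[ℝ] W),
    ω = fun x => (∏ i, f i x) • η}

variable {X W}

/-- The Koszul operator with base point `a`, the contraction with the vector field `x ↦ x - a`
in the first slot of the form. -/
def koszul (a : X) {k : ℕ} :
    (X → V [⋀^Fin (k + 1)]→ₗ[ℝ] W) →ₗ[ℝ] (X → V [⋀^Fin k]→ₗ[ℝ] W) where
  toFun ω x := (ω x).curryLeft (x -ᵥ a)
  map_add' _ _ := rfl
  map_smul' _ _ := rfl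

theorem koszul_apply (a : X) {k : ℕ} (ω : X → V [⋀^Fin (k + 1)]→ₗ[ℝ] W) (x : X) :
    koszul a ω x = (ω x).curryLeft (x -ᵥ a) := rfl

variable (X W)

/-- `𝒫_r⁻ Alt^k(X; W) = 𝒫_{r-1} Alt^k(X; W) + κ 𝒫_{r-1} Alt^{k+1}(X; W)`, for `r ≥ 1`.
An affine space has no distinguished origin, so all base points are admitted in `κ`; by
`prMinus_eq` below each single base point gives the same space. -/
def prMinus (r k : ℕ) : Submodule ℝ (X → V [⋀^Fin k]→ₗ[ℝ] W) :=
  polyForms X W (r - 1) k ⊔ ⨆ a : X, (polyForms X W (r - 1) (k + 1)).map (koszul a)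

theorem prMinus_eq (r k : ℕ) (a : X) :
    prMinus X W r k =
      polyForms X W (r - 1) k ⊔ (polyForms X W (r - 1) (k + 1)).map (koszul a) := by
  apply le_antisymm
  · refine sup_le le_sup_left (iSup_le fun b => ?_)
    rw [polyForms, Submodule.map_span_le]
    rintro _ ⟨f, η, rfl⟩
    have h : koszul b (fun x => (∏ i, f i x) • η) =
        (fun x => (∏ i, f i x) • η.curryLeft (a -ᵥ b)) +
          koszul a (fun x => (∏ i, f i x) • η) := by
      funext x
      rw [Pi.add_apply, koszul_apply, koszul_apply, ← vsub_add_vsub_cancel x a b, map_add, add_comm]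
      rfl
    rw [h]
    refine Submodule.add_mem_sup (Submodule.subset_span ⟨f, _, rfl⟩) ?_
    exact Submodule.mem_map_of_mem (Submodule.subset_span ⟨f, η, rfl⟩)
  · exact sup_le_sup_left (le_iSup (fun a : X => (polyForms X W (r - 1) (k + 1)).map (koszul a)) a) _

end Polynomial

/-! ### Linear algebra of traces -/

section LinearAlgebra

variable {U V W W' : Type*} [AddCommGroup U] [Module ℝ U] [AddCommGroup V] [Module ℝ V]
variable [AddCommGroup W] [Module ℝ W] [AddCommGroup W'] [Module ℝ W']

/-- Restriction of constant forms along a linear map `j : U → V`. -/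
def restrictAlt (j : U →ₗ[ℝ] V) (ℓ : ℕ) :
    (V [⋀^Fin ℓ]→ₗ[ℝ] ℝ) →ₗ[ℝ] (U [⋀^Fin ℓ]→ₗ[ℝ] ℝ) where
  toFun η := η.compLinearMap j
  map_add' _ _ := rfl
  map_smul' _ _ := rfl

/-- Pullback of forms along a map of points `i`, with tangent map `j`, combined with a linear map
`L` of the values: `(x, v) ↦ L (ω (i x) (j v₁, …, j v_k))`. -/
def pullback {X Y : Type*} {k : ℕ} (i : X → Y) (j : U →ₗ[ℝ] V) (L : W →ₗ[ℝ] W') :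
    (Y → V [⋀^Fin k]→ₗ[ℝ] W) →ₗ[ℝ] (X → U [⋀^Fin k]→ₗ[ℝ] W') where
  toFun ω x := (L.compAlternatingMap (ω (i x))).compLinearMap j
  map_add' _ _ := by funext x; ext v; simp
  map_smul' _ _ := by funext x; ext v; simp

theorem append_update_left {α : Type*} {q c : ℕ} (u : Fin q → α) (v : Fin c → α) (i : Fin q)
    (a : α) : Fin.append (Function.update u i a) v =
      Function.update (Fin.append u v) (Fin.castAdd c i) a := by
  funext j
  refine Fin.addCases (fun j => ?_) (fun j => ?_) j
  · by_cases h : j = i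
    · subst h; simp
    · have h' : Fin.castAdd c j ≠ Fin.castAdd c i := by simpa [Fin.ext_iff] using h
      simp [Function.update_of_ne h, Function.update_of_ne h']
  · have h' : Fin.natAdd q j ≠ Fin.castAdd c i := by
      intro h; have := congrArg Fin.val h; simp at this; omega
    simp [Function.update_of_ne h']

theorem append_update_right {α : Type*} {q c : ℕ} (u : Fin q → α) (v : Fin c → α) (i : Fin c)
    (a : α) : Fin.append u (Function.update v i a) =
      Function.update (Fin.append u v) (Fin.natAdd q i) a := by
  funext j
  refine Fin.addCases (fun j => ?_) (fun j => ?_) j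
  · have h' : Fin.castAdd c j ≠ Fin.natAdd q i := by
      intro h; have := congrArg Fin.val h; simp at this; omega
    simp [Function.update_of_ne h']
  · by_cases h : j = i
    · subst h; simp
    · have h' : Fin.natAdd q j ≠ Fin.natAdd q i := by simpa [Fin.ext_iff] using h
      simp [Function.update_of_ne h, Function.update_of_ne h']

theorem comp_update_coe (T : Submodule ℝ V) {q : ℕ} [DecidableEq (Fin q)] (u : Fin q → T)
    (i : Fin q) (a : T) : (fun m => ((Function.update u i a m : T) : V)) =
      Function.update (fun m => (u m : V)) i (a : V) := by
  funext m
  by_cases h : m = i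
  · subst h; simp
  · simp [Function.update_of_ne h]

/-- For subspaces `T` and `N` of `V`, the component in `Alt^q(T) ⊗ Alt^c(N)` of a form of degree
`q + c` on `V`: the first `q` slots are fed with vectors of `T`, the last `c` with vectors
of `N`. -/
def mixed (T N : Submodule ℝ V) (q c : ℕ) :
    (V [⋀^Fin (q + c)]→ₗ[ℝ] ℝ) →ₗ[ℝ] (T [⋀^Fin q]→ₗ[ℝ] (N [⋀^Fin c]→ₗ[ℝ] ℝ)) where
  toFun f :=
    { toFun := fun t =>
        { toFun := fun u => f (Fin.append (fun i => (t i : V)) (fun i => (u i : V)))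
          map_update_add' := by
            intro inst m i x y
            obtain rfl : inst = instDecidableEqFin c := Subsingleton.elim _ _
            simp only [comp_update_coe]
            simp only [append_update_right, Submodule.coe_add, AlternatingMap.map_update_add]
          map_update_smul' := by
            intro inst m i x y
            obtain rfl : inst = instDecidableEqFin c := Subsingleton.elim _ _
            simp only [comp_update_coe]
            simp only [append_update_right, Submodule.coe_smul, AlternatingMap.map_update_smul]
          map_eq_zero_of_eq' := by
            intro v i j hv hij
            refine f.map_eq_zero_of_eq (i := Fin.natAdd q i) (j := Fin.natAdd q j) _ ?_ ?_
            · simp [hv]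
            · simpa [Fin.ext_iff] using hij }
      map_update_add' := by
        intro inst m i x y
        obtain rfl : inst = instDecidableEqFin q := Subsingleton.elim _ _
        ext u
        simp only [comp_update_coe, AlternatingMap.coe_mk, MultilinearMap.coe_mk,
          AlternatingMap.add_apply]
        simp only [append_update_left, Submodule.coe_add, AlternatingMap.map_update_add]
      map_update_smul' := by
        intro inst m i x y
        obtain rfl : inst = instDecidableEqFin q := Subsingleton.elim _ _
        ext u
        simp only [comp_update_coe, AlternatingMap.coe_mk, MultilinearMap.coe_mk,
          AlternatingMap.smul_apply]
        simp only [append_update_left, Submodule.coe_smul, AlternatingMap.map_update_smul]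
      map_eq_zero_of_eq' := by
        intro v i j hv hij
        ext u
        refine f.map_eq_zero_of_eq (i := Fin.castAdd c i) (j := Fin.castAdd c j) _ ?_ ?_
        · simp [hv]
        · simpa [Fin.ext_iff] using hij }
  map_add' _ _ := rfl
  map_smul' _ _ := rfl

end LinearAlgebra

/-- The inner product on `Alt^k(V; W)` induced by that of `V` and a bilinear form `ip` on `W`:
the sum of `ip (α(e_I)) (β(e_I))` over the increasing multi-indices `I` for an orthonormal basis
`e`, written as a sum over all multi-indices divided by `k!`. -/
def altInner {V W : Type*} [NormedAddCommGroup V] [InnerProductSpace ℝ V] [FiniteDimensional ℝ V]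
    [AddCommGroup W] [Module ℝ W] {k : ℕ} (ip : W → W → ℝ) (α β : V [⋀^Fin k]→ₗ[ℝ] W) : ℝ :=
  (k.factorial : ℝ)⁻¹ * ∑ I : Fin k → Fin (Module.finrank ℝ V),
    ip (α fun i => stdOrthonormalBasis ℝ V (I i)) (β fun i => stdOrthonormalBasis ℝ V (I i))

/-! ### Simplices -/

/-- A nondegenerate simplex in Euclidean `n`-space, of any dimension, given by its vertices. -/
@[ext]
structure Simplex (n : ℕ) where
  verts : Finset (Eucl n)
  nonempty : verts.Nonempty
  indep : AffineIndependent ℝ ((↑) : verts → Eucl n)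

namespace Simplex

variable {n : ℕ}

/-- `F ≤ σ`: `F` is a face of `σ` (possibly `σ` itself). -/
instance : LE (Simplex n) := ⟨fun F σ => F.verts ⊆ σ.verts⟩

def dim (σ : Simplex n) : ℕ := σ.verts.card - 1

/-- The affine hull of a simplex.  A polynomial on a simplex is the same as a polynomial on its
affine hull, so polynomial forms on `σ` are taken as functions on `σ.hull`. -/
def hull (σ : Simplex n) : AffineSubspace ℝ (Eucl n) := affineSpan ℝ (σ.verts : Set (Eucl n))

instance (σ : Simplex n) : Nonempty σ.hull :=
  (σ.nonempty.to_set.affineSpan ℝ).to_subtype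

/-- The tangent space of a simplex. -/
abbrev tan (σ : Simplex n) : Submodule ℝ (Eucl n) := σ.hull.direction

/-- The normal space of a simplex in the ambient Euclidean space. -/
abbrev nor (σ : Simplex n) : Submodule ℝ (Eucl n) := σ.hull.directionᗮ

theorem hull_mono {F σ : Simplex n} (h : F ≤ σ) : F.hull ≤ σ.hull :=
  affineSpan_mono ℝ (Finset.coe_subset.2 h)

/-- The tangential inclusion of a face. -/
def tanIncl {F σ : Simplex n} (h : F ≤ σ) : F.tan →ₗ[ℝ] σ.tan :=
  Submodule.inclusion (AffineSubspace.direction_le (hull_mono h))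

/-- The points of the simplex, as a subset of its affine hull. -/
def body (σ : Simplex n) : Set σ.hull := {x | (x : Eucl n) ∈ convexHull ℝ (σ.verts : Set (Eucl n))}

/-- The trace on `σ` of a form on `ℝⁿ` with values in `Alt^ℓ(ℝⁿ)`: the pullback `ι_σ^*` in the first
index, and a given linear map `L` on `Alt^ℓ(ℝⁿ)` in the second. -/
def trace (σ : Simplex n) {k ℓ : ℕ} {W : Type} [AddCommGroup W] [Module ℝ W]
    (L : (Eucl n [⋀^Fin ℓ]→ₗ[ℝ] ℝ) →ₗ[ℝ] W) :
    (Eucl n → Eucl n [⋀^Fin k]→ₗ[ℝ] (Eucl n [⋀^Fin ℓ]→ₗ[ℝ] ℝ)) →ₗ[ℝ]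
      (σ.hull → σ.tan [⋀^Fin k]→ₗ[ℝ] W) :=
  pullback (fun x : σ.hull => (x : Eucl n)) σ.tan.subtype L

/-- `ι_σ^*` on `Alt^ℓ(ℝⁿ)`. -/
def iota (σ : Simplex n) (ℓ : ℕ) :
    (Eucl n [⋀^Fin ℓ]→ₗ[ℝ] ℝ) →ₗ[ℝ] (σ.tan [⋀^Fin ℓ]→ₗ[ℝ] ℝ) :=
  restrictAlt σ.tan.subtype ℓ

/-- The values of the generalized trace `ϑ_{σ,q}^*` of `ℓ`-forms, `Alt^q(σ) ⊗ Alt^{ℓ-q}(σ^⊥)`;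
only used for `q ≤ ℓ`. -/
abbrev TanNor (σ : Simplex n) (ℓ q : ℕ) : Type :=
  σ.tan [⋀^Fin q]→ₗ[ℝ] (σ.nor [⋀^Fin (ℓ - q)]→ₗ[ℝ] ℝ)

/-- `ϑ_{σ,q}^*` on `Alt^ℓ(ℝⁿ)`, the component with `q` tangential and `ℓ - q` normal slots;
it is zero for `q > ℓ`. -/
def vartheta (σ : Simplex n) (ℓ q : ℕ) : (Eucl n [⋀^Fin ℓ]→ₗ[ℝ] ℝ) →ₗ[ℝ] σ.TanNor ℓ q :=
  if h : q ≤ ℓ then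
    (mixed σ.tan σ.nor q (ℓ - q)).comp
      (AlternatingMap.domDomCongrₗ ℝ (finCongr (Nat.add_sub_cancel' h).symm)).toLinearMap
  else 0

/-- `j_σ^* = ϑ_{σ, dim σ}^*` on `Alt^ℓ(ℝⁿ)`, with values in `Alt^{dim σ}(σ) ⊗ Alt^{ℓ - dim σ}(σ^⊥)`,
and zero if `dim σ > ℓ`. -/
def jmath (σ : Simplex n) (ℓ : ℕ) : (Eucl n [⋀^Fin ℓ]→ₗ[ℝ] ℝ) →ₗ[ℝ] σ.TanNor ℓ σ.dim :=
  σ.vartheta ℓ σ.dim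

/-- The tangential degrees `q = dim σ - s`, `0 ≤ s ≤ p - 1`, for which both
`Alt^q(σ)` and `Alt^{ℓ-q}(σ^⊥)` have non-negative degree. -/
def degs (σ : Simplex n) (ℓ p : ℕ) : Finset ℕ :=
  {q ∈ Finset.range (ℓ + 1) | q ≤ σ.dim ∧ σ.dim < q + p}

/-- `⨁_{s=0}^{p-1} Alt^{m-s}(σ) ⊗ Alt^{ℓ-m+s}(σ^⊥)`, `m = dim σ`, without the terms of negative
degree. -/
abbrev TanNorSum (σ : Simplex n) (ℓ p : ℕ) : Type := ∀ q : σ.degs ℓ p, σ.TanNor ℓ q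

/-- `j_{σ,[p]}^*` on `Alt^ℓ(ℝⁿ)`, the direct sum of `ϑ_{σ,m}^*, ϑ_{σ,m-1}^*, …, ϑ_{σ,m-p+1}^*`
where `m = dim σ`. -/
def jmathP (σ : Simplex n) (ℓ p : ℕ) :
    (Eucl n [⋀^Fin ℓ]→ₗ[ℝ] ℝ) →ₗ[ℝ] σ.TanNorSum ℓ p :=
  LinearMap.pi fun q => σ.vartheta ℓ q

/-! #### Inner products -/

def ipAlt (σ : Simplex n) {ℓ : ℕ} : (σ.tan [⋀^Fin ℓ]→ₗ[ℝ] ℝ) → (σ.tan [⋀^Fin ℓ]→ₗ[ℝ] ℝ) → ℝ :=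
  altInner fun a b : ℝ => a * b

def ipTanNor (σ : Simplex n) {ℓ q : ℕ} : σ.TanNor ℓ q → σ.TanNor ℓ q → ℝ :=
  altInner (altInner fun a b : ℝ => a * b)

def ipTanNorSum (σ : Simplex n) {ℓ p : ℕ} (w w' : σ.TanNorSum ℓ p) : ℝ :=
  ∑ q, σ.ipTanNor (w q) (w' q)

/-- The `L²` inner product on `σ` of `W`-valued `k`-forms: the pointwise inner product, integrated
over the simplex with respect to the `dim σ`-dimensional Euclidean volume. -/
def l2Inner (σ : Simplex n) {k : ℕ} {W : Type} [AddCommGroup W] [Module ℝ W] (ip : W → W → ℝ)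
    (α β : σ.hull → σ.tan [⋀^Fin k]→ₗ[ℝ] W) : ℝ :=
  ∫ x in σ.body, altInner ip (α x) (β x) ∂(Measure.euclideanHausdorffMeasure σ.dim)

/-! #### Bubbles -/

/-- `ℬ_r⁻ Alt^k(σ)`: the forms of `𝒫_r⁻ Alt^k(σ)` whose trace `ι_F^*` vanishes on each face `F` of
codimension one. -/
def bubble (σ : Simplex n) (r k : ℕ) : Submodule ℝ (σ.hull → σ.tan [⋀^Fin k]→ₗ[ℝ] ℝ) :=
  prMinus σ.hull ℝ r k ⊓
    ⨅ (F : Simplex n) (h : F ≤ σ) (_ : F.dim + 1 = σ.dim),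
      LinearMap.ker (pullback (k := k) (Set.inclusion (hull_mono h)) (tanIncl h)
        (LinearMap.id : ℝ →ₗ[ℝ] ℝ))

/-- `ℬ_r⁻ Alt^{k,ℓ}(σ)`: the forms of `𝒫_r⁻ Alt^{k,ℓ}(σ)` whose double trace `ι_F^* ι_F^*` vanishes on
each face `F` of codimension one. -/
def bubble₂ (σ : Simplex n) (r k ℓ : ℕ) :
    Submodule ℝ (σ.hull → σ.tan [⋀^Fin k]→ₗ[ℝ] (σ.tan [⋀^Fin ℓ]→ₗ[ℝ] ℝ)) :=
  prMinus σ.hull (σ.tan [⋀^Fin ℓ]→ₗ[ℝ] ℝ) r k ⊓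
    ⨅ (F : Simplex n) (h : F ≤ σ) (_ : F.dim + 1 = σ.dim),
      LinearMap.ker (pullback (k := k) (Set.inclusion (hull_mono h)) (tanIncl h)
        (restrictAlt (tanIncl h) ℓ))

/-- `ℬ_r⁻ Alt^k(σ) ⊗ W`, as a space of `W`-valued `k`-forms on `σ`. -/
def bubbleTensor (σ : Simplex n) (r k : ℕ) (W : Type) [AddCommGroup W] [Module ℝ W] :
    Submodule ℝ (σ.hull → σ.tan [⋀^Fin k]→ₗ[ℝ] W) :=
  Submodule.span ℝ {β | ∃ b ∈ σ.bubble r k, ∃ w : W,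
    β = fun x => (LinearMap.toSpanSingleton ℝ W w).compAlternatingMap (b x)}

end Simplex

/-! ### Finite elements -/

/-- `ℓ`-form-valued `k`-forms on `ℝⁿ`. -/
abbrev DForm (n k ℓ : ℕ) : Type := Eucl n → Eucl n [⋀^Fin k]→ₗ[ℝ] (Eucl n [⋀^Fin ℓ]→ₗ[ℝ] ℝ)

/-- The shape functions `𝒫_r⁻ Alt^{k,ℓ}` on an `n`-simplex in `ℝⁿ`, as polynomial forms on `ℝⁿ`. -/
def shape (n k ℓ r : ℕ) : Submodule ℝ (DForm n k ℓ) :=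
  prMinus (Eucl n) (Eucl n [⋀^Fin ℓ]→ₗ[ℝ] ℝ) r k

/-- The degrees of freedom attached to one simplex: a vector space of test objects `b`, and for each
`b` the functional `ω ↦ val ω b`. -/
structure Dofs (M : Type) where
  Test : Type
  [addCommGroup : AddCommGroup Test]
  [module : Module ℝ Test]
  val : M → Test → ℝ

attribute [instance] Dofs.addCommGroup Dofs.module

/-- No degrees of freedom. -/
def Dofs.none (M : Type) : Dofs M where
  Test := PUnit
  val _ _ := 0

/-- The moments `ω ↦ ⟨ι_σ^* L ω, b⟩_σ` for `b` in the space `B`. -/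
def Dofs.moments {n k ℓ : ℕ} (σ : Simplex n) {W : Type} [AddCommGroup W] [Module ℝ W]
    (ip : W → W → ℝ) (L : (Eucl n [⋀^Fin ℓ]→ₗ[ℝ] ℝ) →ₗ[ℝ] W)
    (B : Submodule ℝ (σ.hull → σ.tan [⋀^Fin k]→ₗ[ℝ] W)) : Dofs (DForm n k ℓ) where
  Test := B
  val ω b := σ.l2Inner ip (σ.trace L ω) b

/-- `⟨ι_σ^* ι_σ^* ω, b⟩_σ` for `b ∈ ℬ_r⁻ Alt^{k,ℓ}(σ)`. -/
def dofsII (n k ℓ r : ℕ) (σ : Simplex n) : Dofs (DForm n k ℓ) :=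
  Dofs.moments σ σ.ipAlt (σ.iota ℓ) (σ.bubble₂ r k ℓ)

/-- With `m = dim σ`: for `m ∈ [k, ℓ]` the moments `⟨ι_σ^* j_σ^* ω, b⟩_σ` for
`b ∈ ℬ_r⁻ Alt^k(σ) ⊗ (Alt^m(σ) ⊗ Alt^{ℓ-m}(σ^⊥))`, where `Alt^m(σ)` is the line of volume forms; for
`m > ℓ` the moments `⟨ι_σ^* ι_σ^* ω, b⟩_σ` for `b ∈ ℬ_r⁻ Alt^{k,ℓ}(σ)`. -/
def dofsIJ (n k ℓ r : ℕ) (σ : Simplex n) : Dofs (DForm n k ℓ) :=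
  if ℓ < σ.dim then dofsII n k ℓ r σ
  else if k ≤ σ.dim then
    Dofs.moments σ σ.ipTanNor (σ.jmath ℓ) (σ.bubbleTensor r k (σ.TanNor ℓ σ.dim))
  else Dofs.none _

/-- With `m = dim σ`: for `m ∈ [k, ℓ + p - 1]` the moments `⟨ι_σ^* j_{σ,[p]}^* ω, b⟩_σ` for
`b ∈ ⨁_{s=0}^{p-1} ℬ_r⁻ Alt^k(σ) ⊗ (Alt^{m-s}(σ) ⊗ Alt^{ℓ-m+s}(σ^⊥))`; for `m ≥ ℓ + p` the moments
`⟨ι_σ^* ι_σ^* ω, b⟩_σ` for `b ∈ ℬ_r⁻ Alt^{k,ℓ}(σ)`. -/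
def dofsIJP (n k ℓ r p : ℕ) (σ : Simplex n) : Dofs (DForm n k ℓ) :=
  if ℓ + p ≤ σ.dim then dofsII n k ℓ r σ
  else if k ≤ σ.dim then
    Dofs.moments σ σ.ipTanNorSum (σ.jmathP ℓ p) (σ.bubbleTensor r k (σ.TanNorSum ℓ p))
  else Dofs.none _

/-- Unisolvence on `K`: values of the degrees of freedom on the faces of `K`, linear in the test
objects of each face and otherwise arbitrary, are attained by exactly one shape function. -/
def Unisolvent {n : ℕ} {M : Type} [AddCommGroup M] [Module ℝ M] (K : Simplex n)
    (V : Submodule ℝ M) (D : Simplex n → Dofs M) : Prop :=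
  ∀ c : ∀ σ : {σ : Simplex n // σ ≤ K}, Module.Dual ℝ (D σ).Test,
    ∃! ω : M, ω ∈ V ∧ ∀ (σ : {σ : Simplex n // σ ≤ K}) (b : (D σ).Test), (D σ).val ω b = c σ b

/-- The `n`-dimensional cells of a simplicial complex in `ℝⁿ`. -/
abbrev Cell {n : ℕ} (𝒯 : Geometry.SimplicialComplex ℝ (Eucl n)) : Type :=
  {K : Simplex n // K.verts ∈ 𝒯.faces ∧ K.dim = n}

/-- The finite element space on a triangulation: on each cell a shape function, such that the degrees
of freedom on a common face of two cells agree. -/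
def feSpace {n : ℕ} {M : Type} [AddCommGroup M] [Module ℝ M]
    (𝒯 : Geometry.SimplicialComplex ℝ (Eucl n)) (V : Submodule ℝ M) (D : Simplex n → Dofs M) :
    Set (Cell 𝒯 → M) :=
  {ω | (∀ K, ω K ∈ V) ∧ ∀ (K K' : Cell 𝒯) (σ : Simplex n), σ ≤ K.1 → σ ≤ K'.1 →
    ∀ b : (D σ).Test, (D σ).val (ω K) b = (D σ).val (ω K') b}

/-- The trace on `σ` of a piecewise form, given by `ι_σ^*` in the first index and by `L` in the
second, is single-valued: the cells that contain `σ` give the same form on `σ`. -/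
def SingleValued {n k ℓ : ℕ} {𝒯 : Geometry.SimplicialComplex ℝ (Eucl n)}
    (ω : Cell 𝒯 → DForm n k ℓ) (σ : Simplex n) (W : Type) [AddCommGroup W] [Module ℝ W]
    (L : (Eucl n [⋀^Fin ℓ]→ₗ[ℝ] ℝ) →ₗ[ℝ] W) : Prop :=
  ∀ K K' : Cell 𝒯, σ ≤ K.1 → σ ≤ K'.1 → σ.trace L (ω K) = σ.trace L (ω K')

/-- `ι^*ι^*`-conformity. -/
def ConformingII {n k ℓ : ℕ} {𝒯 : Geometry.SimplicialComplex ℝ (Eucl n)}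
    (S : Set (Cell 𝒯 → DForm n k ℓ)) : Prop :=
  ∀ ω ∈ S, ∀ σ : Simplex n, SingleValued ω σ (σ.tan [⋀^Fin ℓ]→ₗ[ℝ] ℝ) (σ.iota ℓ)

/-- `ι^*j^*`-conformity. -/
def ConformingIJ {n k ℓ : ℕ} {𝒯 : Geometry.SimplicialComplex ℝ (Eucl n)}
    (S : Set (Cell 𝒯 → DForm n k ℓ)) : Prop :=
  ∀ ω ∈ S, ∀ σ : Simplex n,
    (σ.dim ≤ ℓ → SingleValued ω σ (σ.TanNor ℓ σ.dim) (σ.jmath ℓ)) ∧ (ℓ ≤ σ.dim → SingleValued ω σ (σ.tan [⋀^Fin ℓ]→ₗ[ℝ] ℝ) (σ.iota ℓ))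

/-- `ι^*j_{[p]}^*`-conformity. -/
def ConformingIJP {n k ℓ : ℕ} (p : ℕ) {𝒯 : Geometry.SimplicialComplex ℝ (Eucl n)}
    (S : Set (Cell 𝒯 → DForm n k ℓ)) : Prop :=
  ∀ ω ∈ S, ∀ σ : Simplex n,
    (σ.dim ≤ ℓ + p - 1 → SingleValued ω σ (σ.TanNorSum ℓ p) (σ.jmathP ℓ p)) ∧
      (ℓ + p ≤ σ.dim → SingleValued ω σ (σ.tan [⋀^Fin ℓ]→ₗ[ℝ] ℝ) (σ.iota ℓ))

end FormValued

end

open FormValued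

/-! Separation. Suppose that all degrees of freedom of `ω` on the faces of `σ` vanish. By induction
on the dimension the traces on the facets vanish, so the trace on `σ` is a bubble, hence an
admissible test object, and testing it against itself shows that it is zero
(`LowTraces.trace_eq_zero`). Only two facts about the low-dimensional traces enter: vanishing on a
facet implies vanishing on the simplex, and in the last low dimension vanishing implies that of the
pullback. The three families are therefore instances of one structure, `LowTraces`, with threshold
`c` equal to `0`, `ℓ + 1` and `ℓ + p`. Applied to the difference of two shape functions, the same
argument gives conformity (`LowTraces.singleValued`).

Counting. Existence follows if the degrees of freedom are no more than the dimension of the shape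
space. No dimension formula for bubbles is used; everything is compared with `B`, the sum of the
dimensions of the scalar bubble spaces over the faces `τ` of `K`. Scalar bubbles extend from `τ` to
`K` with zero trace on all faces that do not contain `τ` (`exists_extension`), so `B` is at most the
dimension of scalar `𝒫_r⁻`, and `n.choose ℓ * B` at most that of the shape space. In the other
direction, a double bubble on `σ` is determined by scalar bubble moments, one family for each face
`τ` and each set `I` of `ℓ` vertices, avoiding a base vertex of `τ`, such that `I` and `τ` together
span `σ` (`Simplex.bubble₂_eq_zero`). The value space of the low trace on `τ` is bounded by the
number of sets `I` that with `τ` span a face of dimension less than `c`. For fixed `τ` each of the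
`n.choose ℓ` sets `I` spans one face with `τ` and is counted once (`count_le`), so there are at most
`n.choose ℓ * B` degrees of freedom.

The facet property of the tangential-normal traces holds because the tangent space of `σ` is that of
a facet plus one normal line, and an alternating form takes at most one argument from a line
(`VanishesTangentially.of_facet`). -/

noncomputable section

namespace FormValued

/-! ### Polynomial functions and forms -/

section PolynomialFunctions

variable (X : Type*) {V : Type*} [AddCommGroup V] [Module ℝ V] [AddTorsor V X]

/-- The algebra of polynomial functions on an affine space. -/
def polyFun : Subalgebra ℝ (X → ℝ) :=
  Algebra.adjoin ℝ (Set.range fun f : X →ᵃ[ℝ] ℝ => (f : X → ℝ))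

variable {X}

theorem affine_mem_polyFun (f : X →ᵃ[ℝ] ℝ) : (f : X → ℝ) ∈ polyFun X :=
  Algebra.subset_adjoin ⟨f, rfl⟩

theorem linear_vsub_mem_polyFun (a : X) (L : V →ₗ[ℝ] ℝ) : (fun x : X => L (x -ᵥ a)) ∈ polyFun X :=
  affine_mem_polyFun (L.toAffineMap.comp (AffineEquiv.vaddConst ℝ a).symm.toAffineMap)

theorem prod_affine_mem_polyFun {r : ℕ} (f : Fin r → (X →ᵃ[ℝ] ℝ)) :
    (fun x : X => ∏ i, f i x) ∈ polyFun X := by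
  have h : (fun x : X => ∏ i, f i x) = ∏ i, (f i : X → ℝ) := by
    funext x; simp
  rw [h]
  exact Subalgebra.prod_mem _ fun i _ => affine_mem_polyFun (f i)

/-- Along a line a polynomial function is a polynomial of the parameter. -/
theorem polyFun_lineMap {g : X → ℝ} (hg : g ∈ polyFun X) (x y : X) :
    ∃ q : Polynomial ℝ, ∀ t : ℝ, g (AffineMap.lineMap x y t) = q.eval t := by
  induction hg using Algebra.adjoin_induction with
  | mem g hg =>
    obtain ⟨f, rfl⟩ := hg
    refine ⟨Polynomial.C (f x) + Polynomial.X * Polynomial.C (f y - f x), fun t => ?_⟩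
    simp only [AffineMap.apply_lineMap]
    simp [AffineMap.lineMap_apply]
    ring
  | algebraMap c => exact ⟨Polynomial.C c, fun t => by simp⟩
  | add g h _ _ hg hh =>
    obtain ⟨p, hp⟩ := hg
    obtain ⟨q, hq⟩ := hh
    exact ⟨p + q, fun t => by simp [hp, hq]⟩
  | mul g h _ _ hg hh =>
    obtain ⟨p, hp⟩ := hg
    obtain ⟨q, hq⟩ := hh
    exact ⟨p * q, fun t => by simp [hp, hq]⟩

/-- A polynomial function that vanishes at infinitely many points of a line vanishes on the line. -/
theorem polyFun_lineMap_eq_zero {g : X → ℝ} (hg : g ∈ polyFun X) (x y : X) {s : Set ℝ}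
    (hs : s.Infinite) (h : ∀ t ∈ s, g (AffineMap.lineMap x y t) = 0) (t : ℝ) :
    g (AffineMap.lineMap x y t) = 0 := by
  obtain ⟨q, hq⟩ := polyFun_lineMap hg x y
  have : q = 0 := Polynomial.eq_zero_of_infinite_isRoot q
    (hs.mono fun t ht => by simpa [hq] using h t ht)
  simp [hq, this]

end PolynomialFunctions

section NormedPolynomialFunctions

variable {X V : Type*} [NormedAddCommGroup V] [NormedSpace ℝ V]
variable [MetricSpace X] [NormedAddTorsor V X]

theorem continuous_of_mem_polyFun [FiniteDimensional ℝ V] {g : X → ℝ} (hg : g ∈ polyFun X) :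
    Continuous g := by
  induction hg using Algebra.adjoin_induction with
  | mem g hg =>
    obtain ⟨f, rfl⟩ := hg
    exact f.continuous_of_finiteDimensional
  | algebraMap c => exact continuous_const
  | add g h _ _ hg hh => exact hg.add hh
  | mul g h _ _ hg hh => exact hg.mul hh

/-- A polynomial function that vanishes on an open set vanishes. -/
theorem polyFun_eq_zero_of_isOpen {g : X → ℝ} (hg : g ∈ polyFun X) {U : Set X} (hU : IsOpen U)
    (hne : U.Nonempty) (h : ∀ x ∈ U, g x = 0) : g = 0 := by
  obtain ⟨x, hx⟩ := hne
  funext y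
  have hopen : IsOpen {t : ℝ | AffineMap.lineMap x y t ∈ U} :=
    hU.preimage AffineMap.lineMap_continuous
  -- The parameter `0` gives `x`, an interior point of the open set, so a whole neighbourhood of `0`
  -- consists of zeros; `y` is then reached at `t = 1`.
  have hinf : {t : ℝ | AffineMap.lineMap x y t ∈ U}.Infinite :=
    infinite_of_mem_nhds 0 (hopen.mem_nhds (by simpa using hx))
  simpa using polyFun_lineMap_eq_zero hg x y hinf (fun t ht => h _ ht) 1

end NormedPolynomialFunctions

theorem pullback_apply {X Y U V W W' : Type*} [AddCommGroup U] [Module ℝ U]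
    [AddCommGroup V] [Module ℝ V] [AddCommGroup W] [Module ℝ W] [AddCommGroup W'] [Module ℝ W']
    {k : ℕ} (i : X → Y) (j : V →ₗ[ℝ] U) (L : W →ₗ[ℝ] W')
    (ω : Y → U [⋀^Fin k]→ₗ[ℝ] W) (x : X) (v : Fin k → V) :
    pullback i j L ω x v = L (ω (i x) fun m => j (v m)) := rfl

section PolynomialForms

variable {X V W W' : Type*} [AddCommGroup V] [Module ℝ V] [AddTorsor V X]
variable [AddCommGroup W] [Module ℝ W] [AddCommGroup W'] [Module ℝ W']

theorem polyForms_mem {r k : ℕ} (f : Fin r → (X →ᵃ[ℝ] ℝ)) (η : V [⋀^Fin k]→ₗ[ℝ] W) :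
    (fun x => (∏ i, f i x) • η) ∈ polyForms X W r k :=
  Submodule.subset_span ⟨f, η, rfl⟩

theorem prMinus_mem_const {r k : ℕ} (f : Fin (r - 1) → (X →ᵃ[ℝ] ℝ)) (η : V [⋀^Fin k]→ₗ[ℝ] W) :
    (fun x => (∏ i, f i x) • η) ∈ prMinus X W r k :=
  Submodule.mem_sup_left (polyForms_mem f η)

theorem prMinus_mem_koszul {r k : ℕ} (a : X) (f : Fin (r - 1) → (X →ᵃ[ℝ] ℝ))
    (η : V [⋀^Fin (k + 1)]→ₗ[ℝ] W) :
    (fun x => (∏ i, f i x) • η.curryLeft (x -ᵥ a)) ∈ prMinus X W r k := by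
  rw [prMinus_eq X W r k a]
  exact Submodule.mem_sup_right ⟨_, polyForms_mem f η, rfl⟩

/-- A freely chosen single base point suffices by `prMinus_eq`, so properties stable under linear
combinations are checked on two kinds of generators. -/
theorem prMinus_le {r k : ℕ} (a : X) {S : Submodule ℝ (X → V [⋀^Fin k]→ₗ[ℝ] W)}
    (h₁ : ∀ (f : Fin (r - 1) → (X →ᵃ[ℝ] ℝ)) (η : V [⋀^Fin k]→ₗ[ℝ] W),
      (fun x => (∏ i, f i x) • η) ∈ S)
    (h₂ : ∀ (f : Fin (r - 1) → (X →ᵃ[ℝ] ℝ)) (η : V [⋀^Fin (k + 1)]→ₗ[ℝ] W),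
      (fun x => (∏ i, f i x) • η.curryLeft (x -ᵥ a)) ∈ S) : prMinus X W r k ≤ S := by
  rw [prMinus_eq X W r k a, polyForms, polyForms, sup_le_iff, Submodule.span_le,
    Submodule.map_span_le]
  constructor
  · rintro _ ⟨f, η, rfl⟩
    exact h₁ f η
  · rintro _ ⟨f, η, rfl⟩
    exact h₂ f η

/-- The coefficients of a form in `𝒫_r⁻` are polynomial functions. -/
theorem prMinus_coeff_mem_polyFun {r k : ℕ} {ω : X → V [⋀^Fin k]→ₗ[ℝ] W}
    (hω : ω ∈ prMinus X W r k) (φ : W →ₗ[ℝ] ℝ) (v : Fin k → V) :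
    (fun x => φ (ω x v)) ∈ polyFun X := by
  obtain ⟨a⟩ := (inferInstance : Nonempty X)
  let S : Submodule ℝ (X → V [⋀^Fin k]→ₗ[ℝ] W) :=
    { carrier := {ω | (fun x => φ (ω x v)) ∈ polyFun X}
      add_mem' := fun {α β} hα hβ => by
        have := Subalgebra.add_mem (polyFun X) hα hβ
        simpa [Pi.add_def] using this
      zero_mem' := by
        have := Subalgebra.zero_mem (polyFun X)
        simpa [Pi.zero_def] using this
      smul_mem' := fun c α hα => by
        have := Subalgebra.smul_mem (polyFun X) hα c
        simpa [Pi.smul_def] using this }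
  refine (prMinus_le (S := S) a (fun f η => ?_) fun f η => ?_) hω
  · have := Subalgebra.mul_mem _ (prod_affine_mem_polyFun f)
      (Subalgebra.algebraMap_mem (polyFun X) (φ (η v)))
    change (fun x => φ (((∏ i, f i x) • η) v)) ∈ polyFun X
    simpa [Pi.mul_def] using this
  · have := Subalgebra.mul_mem _ (prod_affine_mem_polyFun f)
      (linear_vsub_mem_polyFun a
        (φ ∘ₗ (LinearMap.mk (M := V [⋀^Fin k]→ₗ[ℝ] W) ⟨fun β => β v, fun _ _ => rfl⟩
          (fun _ _ => rfl)) ∘ₗ η.curryLeft))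
    change (fun x => φ (((∏ i, f i x) • η.curryLeft (x -ᵥ a)) v)) ∈ polyFun X
    simpa [Pi.mul_def] using this

variable {Y U : Type*} [AddCommGroup U] [Module ℝ U] [AddTorsor U Y]

/-- Pullback along an affine map preserves `𝒫_r⁻`. -/
theorem pullback_mem_prMinus {r k : ℕ} (i : X →ᵃ[ℝ] Y) (L : W →ₗ[ℝ] W')
    {ω : Y → U [⋀^Fin k]→ₗ[ℝ] W} (hω : ω ∈ prMinus Y W r k) :
    pullback i i.linear L ω ∈ prMinus X W' r k := by
  obtain ⟨a⟩ := (inferInstance : Nonempty X)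
  -- With base point `i a` in the target and `a` in the source the Koszul terms correspond exactly,
  -- since `i x -ᵥ i a = i.linear (x -ᵥ a)`.
  refine (prMinus_le (S := (prMinus X W' r k).comap (pullback i i.linear L)) (i a)
    (fun f η => ?_) fun f η => ?_) hω
  · rw [Submodule.mem_comap]
    convert prMinus_mem_const (fun m => (f m).comp i)
      ((L.compAlternatingMap η).compLinearMap i.linear) using 1
    funext x
    ext v
    simp [pullback_apply]
  · rw [Submodule.mem_comap]
    convert prMinus_mem_koszul a (fun m => (f m).comp i)
      ((L.compAlternatingMap η).compLinearMap i.linear) using 1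
    funext x
    ext v
    simp only [pullback_apply, AlternatingMap.smul_apply, map_smul, AffineMap.comp_apply,
      AlternatingMap.curryLeft_apply_apply, AlternatingMap.compLinearMap_apply,
      LinearMap.compAlternatingMap_apply, ← AffineMap.linearMap_vsub]
    congr 3
    funext m
    refine Fin.cases ?_ (fun m => ?_) m <;> simp

end PolynomialForms

/-! ### Finite dimensionality of the polynomial spaces -/

section Finite

instance {V W : Type*} [AddCommGroup V] [Module ℝ V] [Module.Finite ℝ V] [AddCommGroup W]
    [Module ℝ W] [Module.Finite ℝ W] (k : ℕ) : Module.Finite ℝ (V [⋀^Fin k]→ₗ[ℝ] W) :=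
  Module.Finite.equiv (exteriorPower.alternatingMapLinearEquiv (R := ℝ) (M := V) (N := W)
    (n := k)).symm

theorem free_alternatingMap {V W : Type*} [AddCommGroup V] [Module ℝ V] [AddCommGroup W]
    [Module ℝ W] (k : ℕ) : Module.Free ℝ (V [⋀^Fin k]→ₗ[ℝ] W) :=
  Module.Free.of_divisionRing ℝ _

theorem finrank_alternatingMap {V W : Type*} [AddCommGroup V] [Module ℝ V] [Module.Finite ℝ V]
    [AddCommGroup W] [Module ℝ W] [Module.Finite ℝ W] (k : ℕ) :
    Module.finrank ℝ (V [⋀^Fin k]→ₗ[ℝ] W) =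
      (Module.finrank ℝ V).choose k * Module.finrank ℝ W := by
  rw [(exteriorPower.alternatingMapLinearEquiv (R := ℝ) (M := V) (N := W) (n := k)).finrank_eq,
    Module.finrank_linearMap, exteriorPower.finrank_eq]

variable (X : Type*) {V : Type*} [AddCommGroup V] [Module ℝ V] [AddTorsor V X]
variable (W : Type*) [AddCommGroup W] [Module ℝ W]
variable [Module.Finite ℝ V] [Module.Finite ℝ W]

instance finite_affineMap : Module.Finite ℝ (X →ᵃ[ℝ] ℝ) := by
  obtain ⟨a⟩ := (inferInstance : Nonempty X)
  let T : (X →ᵃ[ℝ] ℝ) →ₗ[ℝ] ℝ × (V →ₗ[ℝ] ℝ) :=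
    { toFun := fun f => (f a, f.linear)
      map_add' := fun _ _ => rfl
      map_smul' := fun _ _ => rfl }
  refine Module.Finite.of_injective T fun f g h => ?_
  obtain ⟨h₁, h₂⟩ := Prod.mk.inj h
  ext x
  rw [← vsub_vadd x a, f.map_vadd, g.map_vadd, h₁, h₂]

/-- Induction on `r`: expanding one affine factor in a basis of the affine functions puts the space
for `r + 1` into a finite sum of images of the space for `r` under multiplication by the basis
functions. -/
instance finite_polyForms (r k : ℕ) : Module.Finite ℝ (polyForms X (V := V) W r k) := by
  induction r with
  | zero =>
    let T : (V [⋀^Fin k]→ₗ[ℝ] W) →ₗ[ℝ] (X → V [⋀^Fin k]→ₗ[ℝ] W) :=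
      LinearMap.pi fun _ => LinearMap.id
    refine Submodule.finiteDimensional_of_le (S₂ := LinearMap.range T) ?_
    rw [polyForms, Submodule.span_le]
    rintro _ ⟨f, η, rfl⟩
    exact ⟨η, by funext x; simp [T]⟩
  | succ r ih =>
    let b := Module.finBasis ℝ (X →ᵃ[ℝ] ℝ)
    let T : Fin (Module.finrank ℝ (X →ᵃ[ℝ] ℝ)) →
        (X → V [⋀^Fin k]→ₗ[ℝ] W) →ₗ[ℝ] (X → V [⋀^Fin k]→ₗ[ℝ] W) := fun i =>
      LinearMap.pi fun x => (b i x) • LinearMap.proj x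
    refine Submodule.finiteDimensional_of_le
      (S₂ := ⨆ i, (polyForms X (V := V) W r k).map (T i)) ?_
    rw [polyForms, Submodule.span_le]
    rintro _ ⟨f, η, rfl⟩
    have h : (fun x => (∏ i, f i x) • η) =
        ∑ j, b.repr (f 0) j • T j (fun x => (∏ i : Fin r, f i.succ x) • η) := by
      funext x
      have hx : f 0 x = ∑ j, b.repr (f 0) j * b j x := by
        conv_lhs => rw [← b.sum_repr (f 0)]
        have key : ∀ (s : Finset (Fin (Module.finrank ℝ (X →ᵃ[ℝ] ℝ))))
            (g : Fin (Module.finrank ℝ (X →ᵃ[ℝ] ℝ)) → (X →ᵃ[ℝ] ℝ)),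
            (∑ j ∈ s, g j) x = ∑ j ∈ s, g j x := by
          intro s g
          classical
          induction s using Finset.induction_on with
          | empty => simp
          | insert i s hi ih => rw [Finset.sum_insert hi, Finset.sum_insert hi, ← ih]; rfl
        rw [key]
        rfl
      rw [Fin.prod_univ_succ, hx, Finset.sum_apply, mul_smul, Finset.sum_smul]
      exact Finset.sum_congr rfl fun j _ => by simp [T, mul_smul]
    rw [h]
    exact Submodule.sum_mem _ fun j _ => Submodule.smul_mem _ _
      (Submodule.mem_iSup_of_mem j ⟨_, polyForms_mem _ η, rfl⟩)

instance finite_prMinus (r k : ℕ) : Module.Finite ℝ (prMinus X (V := V) W r k) := by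
  obtain ⟨a⟩ := (inferInstance : Nonempty X)
  rw [prMinus_eq X W r k a]
  infer_instance

variable {X W} in
theorem finite_of_le_prMinus {r k : ℕ} {S : Submodule ℝ (X → V [⋀^Fin k]→ₗ[ℝ] W)}
    (h : S ≤ prMinus X W r k) : Module.Finite ℝ S :=
  Submodule.finiteDimensional_of_le h

end Finite

instance free_submodule_forms {X V W : Type*} [AddCommGroup V] [Module ℝ V] [AddCommGroup W]
    [Module ℝ W] {k : ℕ} (S : Submodule ℝ (X → V [⋀^Fin k]→ₗ[ℝ] W)) : Module.Free ℝ S :=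
  Module.Free.of_divisionRing ℝ S

theorem alternatingMap_sum_apply {V W ι κ : Type*} [AddCommGroup V] [Module ℝ V] [AddCommGroup W]
    [Module ℝ W] (s : Finset κ) (f : κ → V [⋀^ι]→ₗ[ℝ] W) (v : ι → V) :
    (∑ i ∈ s, f i) v = ∑ i ∈ s, f i v :=
  map_sum (AddMonoidHom.mk (⟨fun f : V [⋀^ι]→ₗ[ℝ] W => f v, rfl⟩) fun _ _ => rfl) f s

/-! ### Inner products of forms -/

section Inner

variable {V W : Type*} [NormedAddCommGroup V] [InnerProductSpace ℝ V] [FiniteDimensional ℝ V]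
variable [AddCommGroup W] [Module ℝ W]

/-- A positive definite bilinear form on a real vector space. -/
structure IsInner (ip : W → W → ℝ) : Prop where
  bilin : ∃ B : W →ₗ[ℝ] W →ₗ[ℝ] ℝ, ∀ a b, ip a b = B a b
  nonneg : ∀ a, 0 ≤ ip a a
  definite : ∀ a, ip a a = 0 → a = 0

theorem isInner_mul : IsInner fun a b : ℝ => a * b where
  bilin := ⟨LinearMap.mul ℝ ℝ, fun _ _ => rfl⟩
  nonneg := mul_self_nonneg
  definite _ := mul_self_eq_zero.1

theorem IsInner.altInner {k : ℕ} {ip : W → W → ℝ} (h : IsInner ip) :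
    IsInner (altInner (V := V) (k := k) ip) where
  bilin := by
    obtain ⟨B, hB⟩ := h.bilin
    refine ⟨LinearMap.mk₂ ℝ (FormValued.altInner (V := V) (k := k) ip) ?_ ?_ ?_ ?_,
      fun _ _ => rfl⟩
    · intro α β γ
      simp only [FormValued.altInner, hB, AlternatingMap.add_apply, map_add, LinearMap.add_apply,
        Finset.sum_add_distrib, mul_add]
    · intro c α β
      simp only [FormValued.altInner, hB, AlternatingMap.smul_apply, map_smul, LinearMap.smul_apply,
        smul_eq_mul, ← Finset.mul_sum]
      ring
    · intro α β γ
      simp only [FormValued.altInner, hB, AlternatingMap.add_apply, map_add,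
        Finset.sum_add_distrib, mul_add]
    · intro c α β
      simp only [FormValued.altInner, hB, AlternatingMap.smul_apply, map_smul,
        smul_eq_mul, ← Finset.mul_sum]
      ring
  nonneg α := mul_nonneg (by positivity) (Finset.sum_nonneg fun I _ => h.nonneg _)
  definite α hα := by
    -- A vanishing sum of nonnegative terms makes the form zero on all tuples of basis vectors,
    -- which determine it.
    have hk : ((k.factorial : ℝ)⁻¹) ≠ 0 := by positivity
    have h0 := (mul_eq_zero.1 hα).resolve_left hk
    rw [Finset.sum_eq_zero_iff_of_nonneg fun I _ => h.nonneg _] at h0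
    refine Module.Basis.ext_alternating (stdOrthonormalBasis ℝ V).toBasis fun v _ => ?_
    simpa using h.definite _ (h0 v (Finset.mem_univ _))

theorem IsInner.pi {ι : Type*} [Fintype ι] {E : ι → Type*} [∀ i, AddCommGroup (E i)]
    [∀ i, Module ℝ (E i)] {ip : ∀ i, E i → E i → ℝ} (h : ∀ i, IsInner (ip i)) :
    IsInner fun a b : ∀ i, E i => ∑ i, ip i (a i) (b i) where
  bilin := by
    choose B hB using fun i => (h i).bilin
    refine ⟨∑ i, (B i).compl₁₂ (LinearMap.proj i) (LinearMap.proj i), fun a b => ?_⟩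
    simp [hB]
  nonneg a := Finset.sum_nonneg fun i _ => (h i).nonneg _
  definite a ha := by
    rw [Finset.sum_eq_zero_iff_of_nonneg fun i _ => (h i).nonneg _] at ha
    funext i
    exact (h i).definite _ (ha i (Finset.mem_univ _))

/-- The bilinear form expands over a basis of `W` into products of polynomial coefficients.
Polynomiality of the integrand gives both integrability and definiteness of the `L²` product. -/
theorem altInner_mem_polyFun {X : Type*} [AddTorsor V X] [Module.Finite ℝ W] {r k : ℕ}
    {ip : W → W → ℝ} (h : IsInner ip) {α β : X → V [⋀^Fin k]→ₗ[ℝ] W}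
    (hα : α ∈ prMinus X W r k) (hβ : β ∈ prMinus X W r k) :
    (fun x => altInner ip (α x) (β x)) ∈ polyFun X := by
  obtain ⟨B, hB⟩ := h.bilin
  let b := Module.finBasis ℝ W
  have key : ∀ v : Fin k → V, (fun x => ip (α x v) (β x v)) ∈ polyFun X := by
    intro v
    have : (fun x => ip (α x v) (β x v)) =
        ∑ i, (fun x => b.coord i (α x v)) * fun x => B (b i) (β x v) := by
      funext x
      rw [hB]
      conv_lhs => rw [← b.sum_repr (α x v)]
      simp only [map_sum, map_smul, LinearMap.sum_apply, LinearMap.smul_apply, smul_eq_mul,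
        Finset.sum_apply, Pi.mul_apply, Module.Basis.coord_apply]
    rw [this]
    exact Subalgebra.sum_mem _ fun i _ => Subalgebra.mul_mem _
      (prMinus_coeff_mem_polyFun hα _ v) (prMinus_coeff_mem_polyFun hβ _ v)
  have : (fun x => altInner ip (α x) (β x)) = ((k.factorial : ℝ)⁻¹) •
      ∑ I : Fin k → Fin (Module.finrank ℝ V), fun x =>
        ip (α x fun i => stdOrthonormalBasis ℝ V (I i))
          (β x fun i => stdOrthonormalBasis ℝ V (I i)) := by
    funext x
    simp [altInner]
  rw [this]
  exact Subalgebra.smul_mem _ (Subalgebra.sum_mem _ fun I _ => key _) _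

end Inner

namespace Simplex

variable {n : ℕ} (σ : Simplex n)

theorem card_verts : σ.verts.card = σ.dim + 1 := by
  have := σ.nonempty.card_pos
  unfold dim
  omega

theorem finrank_tan : Module.finrank ℝ σ.tan = σ.dim := by
  have h := σ.indep.finrank_vectorSpan (n := σ.dim) (by simpa using σ.card_verts)
  have e : σ.tan = vectorSpan ℝ (Set.range ((↑) : σ.verts → Eucl n)) := by
    rw [tan, hull, direction_affineSpan, Subtype.range_coe]
  exact (LinearEquiv.ofEq _ _ e).finrank_eq.trans h

theorem ipAlt_isInner {ℓ : ℕ} : IsInner (σ.ipAlt (ℓ := ℓ)) := isInner_mul.altInner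

theorem ipTanNor_isInner {ℓ q : ℕ} : IsInner (σ.ipTanNor (ℓ := ℓ) (q := q)) :=
  isInner_mul.altInner.altInner

theorem ipTanNorSum_isInner {ℓ p : ℕ} : IsInner (σ.ipTanNorSum (ℓ := ℓ) (p := p)) :=
  IsInner.pi fun _ => σ.ipTanNor_isInner

/-! ### The volume measure of a simplex -/

/-- Through a choice of origin the Hausdorff measure on the hull becomes Lebesgue measure on the
tangent space, from which positivity on open sets and finiteness on compact sets are inherited. -/
theorem volume_eq (a : σ.hull) :
    (Measure.euclideanHausdorffMeasure σ.dim : Measure σ.hull) =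
      Measure.map (IsometryEquiv.vaddConst a) (volume : Measure σ.tan) := by
  rw [← EuclideanGeometry.euclideanHausdorffMeasure_eq a, finrank_tan]

instance : (Measure.euclideanHausdorffMeasure σ.dim : Measure σ.hull).IsOpenPosMeasure := by
  obtain ⟨a⟩ := (inferInstance : Nonempty σ.hull)
  rw [σ.volume_eq a]
  exact (IsometryEquiv.vaddConst a).continuous.isOpenPosMeasure_map
    (IsometryEquiv.vaddConst a).surjective

instance : IsFiniteMeasureOnCompacts
    (Measure.euclideanHausdorffMeasure σ.dim : Measure σ.hull) := by
  obtain ⟨a⟩ := (inferInstance : Nonempty σ.hull)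
  rw [σ.volume_eq a]
  exact Measure.IsFiniteMeasureOnCompacts.map volume (IsometryEquiv.vaddConst a).toHomeomorph

theorem isCompact_body : IsCompact σ.body :=
  (AffineSubspace.closed_of_finiteDimensional σ.hull).isClosedEmbedding_subtypeVal.isCompact_preimage
    ((Finset.finite_toSet _).isCompact_convexHull ℝ)

theorem interior_body_nonempty : (interior σ.body).Nonempty := by
  -- The intrinsic interior lives in the affine span of the convex hull, which equals `σ.hull` only
  -- propositionally; a variable `A` allows the equality to be eliminated.
  have key : ∀ A : AffineSubspace ℝ (Eucl n),
      A = affineSpan ℝ (convexHull ℝ (σ.verts : Set (Eucl n))) →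
      (interior (((↑) : A → Eucl n) ⁻¹' convexHull ℝ (σ.verts : Set (Eucl n)))).Nonempty := by
    rintro A rfl
    have h := (σ.nonempty.to_set.convexHull (𝕜 := ℝ)).intrinsicInterior (convex_convexHull ℝ _)
    rw [intrinsicInterior] at h
    exact h.of_image
  exact key σ.hull (affineSpan_convexHull _).symm

/-! ### The inner product on polynomial forms -/

section L2

variable {σ} {k r : ℕ} {W : Type} [AddCommGroup W] [Module ℝ W]
variable {ip : W → W → ℝ} {α α' β : σ.hull → σ.tan [⋀^Fin k]→ₗ[ℝ] W}

theorem integrableOn_altInner [Module.Finite ℝ W] (hip : IsInner ip) (hα : α ∈ prMinus σ.hull W r k)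
    (hβ : β ∈ prMinus σ.hull W r k) :
    IntegrableOn (fun x => altInner ip (α x) (β x)) σ.body
      (Measure.euclideanHausdorffMeasure σ.dim) :=
  (continuous_of_mem_polyFun (altInner_mem_polyFun hip hα hβ)).continuousOn.integrableOn_compact
    σ.isCompact_body

/-- Additivity requires integrability, because non-integrable functions have integral zero by
convention. Polynomial forms are continuous and the simplex is compact. -/
theorem l2Inner_add_left [Module.Finite ℝ W] (hip : IsInner ip) (hα : α ∈ prMinus σ.hull W r k)
    (hα' : α' ∈ prMinus σ.hull W r k) (hβ : β ∈ prMinus σ.hull W r k) :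
    σ.l2Inner ip (α + α') β = σ.l2Inner ip α β + σ.l2Inner ip α' β := by
  rw [l2Inner, l2Inner, l2Inner, ← integral_add (integrableOn_altInner hip hα hβ)
    (integrableOn_altInner hip hα' hβ)]
  obtain ⟨B, hB⟩ := (hip.altInner (V := σ.tan) (k := k)).bilin
  simp [hB]

theorem l2Inner_smul_left (hip : IsInner ip) (c : ℝ) :
    σ.l2Inner ip (c • α) β = c * σ.l2Inner ip α β := by
  rw [l2Inner, l2Inner, ← integral_const_mul]
  obtain ⟨B, hB⟩ := (hip.altInner (V := σ.tan) (k := k)).bilin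
  simp [hB]

theorem l2Inner_add_right [Module.Finite ℝ W] (hip : IsInner ip) (hα : α ∈ prMinus σ.hull W r k)
    (hα' : α' ∈ prMinus σ.hull W r k) (hβ : β ∈ prMinus σ.hull W r k) :
    σ.l2Inner ip β (α + α') = σ.l2Inner ip β α + σ.l2Inner ip β α' := by
  rw [l2Inner, l2Inner, l2Inner, ← integral_add (integrableOn_altInner hip hβ hα)
    (integrableOn_altInner hip hβ hα')]
  obtain ⟨B, hB⟩ := (hip.altInner (V := σ.tan) (k := k)).bilin
  simp [hB]

theorem l2Inner_smul_right (hip : IsInner ip) (c : ℝ) :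
    σ.l2Inner ip β (c • α) = c * σ.l2Inner ip β α := by
  rw [l2Inner, l2Inner, ← integral_const_mul]
  obtain ⟨B, hB⟩ := (hip.altInner (V := σ.tan) (k := k)).bilin
  simp [hB]

/-- The `L²` inner product on a simplex is definite on polynomial forms. -/
theorem eq_zero_of_l2Inner_self [Module.Finite ℝ W] (hip : IsInner ip) (hα : α ∈ prMinus σ.hull W r k)
    (h : σ.l2Inner ip α α = 0) : α = 0 := by
  have hpoly := altInner_mem_polyFun hip hα hα
  have hcont := continuous_of_mem_polyFun hpoly
  have hnn : ∀ x, 0 ≤ altInner ip (α x) (α x) := fun x => hip.altInner.nonneg _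
  have hae := (setIntegral_eq_zero_iff_of_nonneg_ae (Filter.Eventually.of_forall hnn)
    (integrableOn_altInner hip hα hα)).1 h
  -- Vanishing almost everywhere becomes vanishing everywhere on the interior by continuity, and
  -- then on the whole hull because the integrand is polynomial.
  have hinter : ∀ x ∈ interior σ.body, altInner ip (α x) (α x) = 0 :=
    Measure.eqOn_open_of_ae_eq (ae_restrict_of_ae_restrict_of_subset interior_subset hae)
      isOpen_interior hcont.continuousOn continuousOn_const
  have hzero := polyFun_eq_zero_of_isOpen hpoly isOpen_interior σ.interior_body_nonempty hinter
  funext x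
  exact hip.altInner.definite _ (congrFun hzero x)

end L2

end Simplex

namespace Simplex

/-! ### Faces -/

section Faces

variable {n : ℕ}

theorem le_refl (σ : Simplex n) : σ ≤ σ := Finset.Subset.refl _

theorem le_trans {F σ τ : Simplex n} (h : F ≤ σ) (h' : σ ≤ τ) : F ≤ τ := Finset.Subset.trans h h'

/-- The face of `σ` spanned by a nonempty set of vertices. -/
def face (σ : Simplex n) (s : Finset (Eucl n)) (hs : s ⊆ σ.verts) (hne : s.Nonempty) :
    Simplex n where
  verts := s
  nonempty := hne
  indep := σ.indep.mono (Finset.coe_subset.2 hs)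

theorem dim_le_of_le {F σ : Simplex n} (h : F ≤ σ) : F.dim ≤ σ.dim := by
  have := Finset.card_le_card h
  rw [card_verts, card_verts] at this
  omega

theorem eq_of_le_of_dim_eq {F σ : Simplex n} (h : F ≤ σ) (hd : F.dim = σ.dim) : F = σ := by
  ext1
  exact Finset.eq_of_subset_of_card_le h (by rw [card_verts, card_verts, hd])

/-- The facet of `σ` opposite to a vertex. -/
theorem exists_facet {σ : Simplex n} {w : Eucl n} (hw : w ∈ σ.verts)
    (hne : (σ.verts.erase w).Nonempty) :
    ∃ F : Simplex n, F ≤ σ ∧ F.dim + 1 = σ.dim ∧ F.verts = σ.verts.erase w := by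
  refine ⟨σ.face _ (Finset.erase_subset w _) hne, Finset.erase_subset w _, ?_, rfl⟩
  have h1 := card_verts (σ.face _ (Finset.erase_subset w _) hne)
  have h2 := σ.card_verts
  have h3 := Finset.card_erase_of_mem hw
  change (σ.verts.erase w).card = _ at h1
  omega

instance finite_faces (K : Simplex n) : Finite {σ : Simplex n // σ ≤ K} := by
  refine Finite.of_injective
    (fun σ => (⟨σ.1.verts, Finset.mem_powerset.2 σ.2⟩ : K.verts.powerset)) fun σ τ h => ?_
  exact Subtype.ext (Simplex.ext (congrArg Subtype.val h))

instance (K : Simplex n) : Fintype {σ : Simplex n // σ ≤ K} := Fintype.ofFinite _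

theorem vert_mem_hull {σ : Simplex n} {v : Eucl n} (hv : v ∈ σ.verts) : v ∈ σ.hull :=
  subset_affineSpan ℝ _ hv

theorem sub_mem_tan {σ : Simplex n} {v w : Eucl n} (hv : v ∈ σ.verts) (hw : w ∈ σ.verts) :
    v - w ∈ σ.tan :=
  AffineSubspace.vsub_mem_direction (vert_mem_hull hv) (vert_mem_hull hw)

end Faces

/-! ### Traces of polynomial forms -/

section Traces

variable {n : ℕ} {F σ τ : Simplex n} {k ℓ r : ℕ} {W W' : Type} [AddCommGroup W] [Module ℝ W]
  [AddCommGroup W'] [Module ℝ W']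

/-- The trace on a face of a form on `σ`, combined with a linear map of the values. -/
abbrev faceTrace (h : F ≤ σ) (L : W →ₗ[ℝ] W') :
    (σ.hull → σ.tan [⋀^Fin k]→ₗ[ℝ] W) →ₗ[ℝ] (F.hull → F.tan [⋀^Fin k]→ₗ[ℝ] W') :=
  pullback (k := k) (Set.inclusion (hull_mono h)) (tanIncl h) L

/-- A linear map of the values of a form. -/
abbrev mapVal (σ : Simplex n) (L : W →ₗ[ℝ] W') :
    (σ.hull → σ.tan [⋀^Fin k]→ₗ[ℝ] W) →ₗ[ℝ] (σ.hull → σ.tan [⋀^Fin k]→ₗ[ℝ] W') :=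
  pullback (k := k) id LinearMap.id L

theorem faceTrace_mem (h : F ≤ σ) (L : W →ₗ[ℝ] W') {α : σ.hull → σ.tan [⋀^Fin k]→ₗ[ℝ] W}
    (hα : α ∈ prMinus σ.hull W r k) : faceTrace h L α ∈ prMinus F.hull W' r k :=
  pullback_mem_prMinus (AffineSubspace.inclusion (hull_mono h)) L hα

theorem mapVal_mem (L : W →ₗ[ℝ] W') {α : σ.hull → σ.tan [⋀^Fin k]→ₗ[ℝ] W}
    (hα : α ∈ prMinus σ.hull W r k) : σ.mapVal L α ∈ prMinus σ.hull W' r k :=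
  pullback_mem_prMinus (AffineMap.id ℝ σ.hull) L hα

theorem trace_mem (σ : Simplex n) (L : (Eucl n [⋀^Fin ℓ]→ₗ[ℝ] ℝ) →ₗ[ℝ] W) {ω : DForm n k ℓ}
    (hω : ω ∈ shape n k ℓ r) : σ.trace L ω ∈ prMinus σ.hull W r k :=
  pullback_mem_prMinus σ.hull.subtype L hω

theorem trace_apply (σ : Simplex n) (L : (Eucl n [⋀^Fin ℓ]→ₗ[ℝ] ℝ) →ₗ[ℝ] W) (ω : DForm n k ℓ)
    (x : σ.hull) (v : Fin k → σ.tan) : σ.trace L ω x v = L (ω x fun i => v i) := rfl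

theorem trace_eq_zero_iff {L : (Eucl n [⋀^Fin ℓ]→ₗ[ℝ] ℝ) →ₗ[ℝ] W} {ω : DForm n k ℓ} :
    σ.trace L ω = 0 ↔ ∀ (x : σ.hull) (v : Fin k → σ.tan), L (ω x fun i => v i) = 0 := by
  constructor
  · intro h x v
    rw [← trace_apply, h]
    rfl
  · intro h
    funext x
    ext v
    exact h x v

theorem faceTrace_eq_zero_iff {h : F ≤ σ} {L : W →ₗ[ℝ] W'}
    {α : σ.hull → σ.tan [⋀^Fin k]→ₗ[ℝ] W} :
    faceTrace h L α = 0 ↔ ∀ (x : F.hull) (v : Fin k → F.tan),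
      L (α (Set.inclusion (hull_mono h) x) fun i => tanIncl h (v i)) = 0 := by
  constructor
  · intro h0 x v
    rw [← pullback_apply, h0]
    rfl
  · intro h0
    funext x
    ext v
    exact h0 x v

theorem form_eq_zero_of_dim_lt (h : σ.dim < k) (α : σ.hull → σ.tan [⋀^Fin k]→ₗ[ℝ] W) : α = 0 := by
  funext x
  ext v
  refine AlternatingMap.map_linearDependent (α x) v fun hv => ?_
  have := hv.fintype_card_le_finrank
  rw [finrank_tan, Fintype.card_fin] at this
  omega

/-! ### Bubbles with values in a vector space -/

theorem mem_bubble_iff {α : σ.hull → σ.tan [⋀^Fin k]→ₗ[ℝ] ℝ} :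
    α ∈ σ.bubble r k ↔ α ∈ prMinus σ.hull ℝ r k ∧
      ∀ (F : Simplex n) (h : F ≤ σ), F.dim + 1 = σ.dim → faceTrace h LinearMap.id α = 0 := by
  simp [bubble, Submodule.mem_inf, Submodule.mem_iInf]

theorem mem_bubble₂_iff {α : σ.hull → σ.tan [⋀^Fin k]→ₗ[ℝ] (σ.tan [⋀^Fin ℓ]→ₗ[ℝ] ℝ)} :
    α ∈ σ.bubble₂ r k ℓ ↔ α ∈ prMinus σ.hull (σ.tan [⋀^Fin ℓ]→ₗ[ℝ] ℝ) r k ∧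
      ∀ (F : Simplex n) (h : F ≤ σ), F.dim + 1 = σ.dim →
        faceTrace h (restrictAlt (tanIncl h) ℓ) α = 0 := by
  simp [bubble₂, Submodule.mem_inf, Submodule.mem_iInf]

theorem bubble_le : σ.bubble r k ≤ prMinus σ.hull ℝ r k := inf_le_left

theorem bubble₂_le : σ.bubble₂ r k ℓ ≤ prMinus σ.hull (σ.tan [⋀^Fin ℓ]→ₗ[ℝ] ℝ) r k := inf_le_left

theorem bubbleTensor_le : σ.bubbleTensor r k W ≤ prMinus σ.hull W r k := by
  rw [bubbleTensor, Submodule.span_le]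
  rintro _ ⟨b, hb, w, rfl⟩
  exact mapVal_mem (LinearMap.toSpanSingleton ℝ W w) (bubble_le hb)

instance : Module.Finite ℝ (σ.bubble r k) := finite_of_le_prMinus bubble_le

instance : Module.Finite ℝ (σ.bubble₂ r k ℓ) := finite_of_le_prMinus bubble₂_le

instance [Module.Finite ℝ W] : Module.Finite ℝ (σ.bubbleTensor r k W) :=
  finite_of_le_prMinus bubbleTensor_le

theorem form_eq_sum_coord [Module.Finite ℝ W] (α : σ.hull → σ.tan [⋀^Fin k]→ₗ[ℝ] W) :
    α = ∑ i, fun x => (LinearMap.toSpanSingleton ℝ W (Module.finBasis ℝ W i)).compAlternatingMap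
      (σ.mapVal ((Module.finBasis ℝ W).coord i) α x) := by
  funext x
  ext v
  simp [pullback_apply, Finset.sum_apply, alternatingMap_sum_apply]

/-- A form of `𝒫_r⁻` with vanishing traces on the facets is a bubble, also for vector values. -/
theorem mem_bubbleTensor [Module.Finite ℝ W] {α : σ.hull → σ.tan [⋀^Fin k]→ₗ[ℝ] W}
    (hα : α ∈ prMinus σ.hull W r k)
    (hF : ∀ (F : Simplex n) (h : F ≤ σ), F.dim + 1 = σ.dim →
      faceTrace h (LinearMap.id : W →ₗ[ℝ] W) α = 0) : α ∈ σ.bubbleTensor r k W := by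
  -- Each coordinate of `α` in a basis of `W` is a scalar bubble.
  rw [form_eq_sum_coord α]
  refine Submodule.sum_mem _ fun i _ => Submodule.subset_span ⟨_, ?_, _, rfl⟩
  refine mem_bubble_iff.2 ⟨mapVal_mem _ hα, fun F h hd => ?_⟩
  rw [faceTrace_eq_zero_iff]
  intro x v
  have := faceTrace_eq_zero_iff.1 (hF F h hd) x v
  simp only [LinearMap.id_apply] at this
  simp [pullback_apply, this]

/-- One scalar bubble for each basis vector of `W` produces the whole space; the upper bound is all
the count needs. -/
theorem finrank_bubbleTensor_le [Module.Finite ℝ W] :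
    Module.finrank ℝ (σ.bubbleTensor r k W) ≤
      Module.finrank ℝ (σ.bubble r k) * Module.finrank ℝ W := by
  let T : (Fin (Module.finrank ℝ W) → σ.bubble r k) →ₗ[ℝ] (σ.hull → σ.tan [⋀^Fin k]→ₗ[ℝ] W) :=
    ∑ i, σ.mapVal (LinearMap.toSpanSingleton ℝ W (Module.finBasis ℝ W i)) ∘ₗ
      (σ.bubble r k).subtype ∘ₗ LinearMap.proj i
  have hle : σ.bubbleTensor r k W ≤ LinearMap.range T := by
    rw [bubbleTensor, Submodule.span_le]
    rintro _ ⟨b, hb, w, rfl⟩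
    refine ⟨fun i => (Module.finBasis ℝ W).repr w i • ⟨b, hb⟩, ?_⟩
    funext x
    ext v
    have := (Module.finBasis ℝ W).sum_repr w
    simp only [T, LinearMap.sum_apply, LinearMap.comp_apply, LinearMap.proj_apply, map_smul,
      Finset.sum_apply, alternatingMap_sum_apply, Pi.smul_apply, AlternatingMap.smul_apply,
      pullback_apply, Submodule.subtype_apply, LinearMap.toSpanSingleton_apply,
      LinearMap.compAlternatingMap_apply, LinearMap.id_apply, id_eq]
    conv_rhs => rw [← this, Finset.smul_sum]
    exact Finset.sum_congr rfl fun i _ => smul_comm _ _ _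
  calc Module.finrank ℝ (σ.bubbleTensor r k W) ≤ Module.finrank ℝ (LinearMap.range T) :=
        Submodule.finrank_mono hle
    _ ≤ Module.finrank ℝ (Fin (Module.finrank ℝ W) → σ.bubble r k) := LinearMap.finrank_range_le T
    _ = _ := by
      have := free_submodule_forms (σ.bubble r k)
      rw [Module.finrank_pi_fintype, Finset.sum_const, Finset.card_univ, Fintype.card_fin,
        smul_eq_mul, mul_comm]

end Traces

end Simplex

/-! ### Traces on the simplices of low dimension -/

/-- Linear maps `L σ` of `Alt^ℓ(ℝⁿ)`, to be used in the second index on the simplices `σ` of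
dimension less than `c`.  If `L` vanishes on a facet then it vanishes on the simplex, and on the
simplices of dimension `c - 1` it determines the pullback. -/
structure LowTraces (n ℓ c : ℕ) where
  W : Simplex n → Type
  [addCommGroup : ∀ σ, AddCommGroup (W σ)]
  [module : ∀ σ, Module ℝ (W σ)]
  [finite : ∀ σ, Module.Finite ℝ (W σ)]
  ip : ∀ σ, W σ → W σ → ℝ
  L : ∀ σ, (Eucl n [⋀^Fin ℓ]→ₗ[ℝ] ℝ) →ₗ[ℝ] W σ
  isInner : ∀ σ, IsInner (ip σ)
  facet : ∀ F σ : Simplex n, F ≤ σ → F.dim + 1 = σ.dim → σ.dim < c →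
    ∀ η, L F η = 0 → L σ η = 0
  top : ∀ F : Simplex n, F.dim + 1 = c → ∀ η, L F η = 0 → F.iota ℓ η = 0

attribute [instance] LowTraces.addCommGroup LowTraces.module LowTraces.finite

namespace LowTraces

variable {n ℓ c : ℕ} (T : LowTraces n ℓ c) (k r : ℕ)

/-- The degrees of freedom with the traces `L σ` for `dim σ < c` and the double pullback for
`dim σ ≥ c`. -/
def dofs (σ : Simplex n) : Dofs (DForm n k ℓ) :=
  if c ≤ σ.dim then dofsII n k ℓ r σ
  else if k ≤ σ.dim then Dofs.moments σ (T.ip σ) (T.L σ) (σ.bubbleTensor r k (T.W σ))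
  else Dofs.none _

variable {T k r} {σ : Simplex n}

theorem dofs_of_le (h : c ≤ σ.dim) : T.dofs k r σ = dofsII n k ℓ r σ := if_pos h

theorem dofs_of_lt (h : σ.dim < c) (hk : k ≤ σ.dim) :
    T.dofs k r σ = Dofs.moments σ (T.ip σ) (T.L σ) (σ.bubbleTensor r k (T.W σ)) := by
  rw [dofs, if_neg h.not_ge, if_pos hk]

theorem dofs_of_lt_of_lt (h : σ.dim < c) (hk : σ.dim < k) : T.dofs k r σ = Dofs.none _ := by
  rw [dofs, if_neg h.not_ge, if_neg hk.not_ge]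

/-- If all degrees of freedom on the faces of `σ` vanish, then so does the trace on `σ`. -/
theorem trace_eq_zero {ω : DForm n k ℓ} (hω : ω ∈ shape n k ℓ r)
    (h : ∀ τ : Simplex n, τ ≤ σ → ∀ b : (T.dofs k r τ).Test, (T.dofs k r τ).val ω b = 0) :
    (σ.dim < c → σ.trace (T.L σ) ω = 0) ∧ (c ≤ σ.dim → σ.trace (σ.iota ℓ) ω = 0) := by
  -- Every face of a facet of `σ` is a face of `σ`, so the hypothesis on the degrees of freedom
  -- passes to facets.
  induction hd : σ.dim using Nat.strong_induction_on generalizing σ with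
  | _ d ih =>
  have ih' : ∀ F : Simplex n, F ≤ σ → F.dim + 1 = σ.dim →
      (F.dim < c → F.trace (T.L F) ω = 0) ∧ (c ≤ F.dim → F.trace (F.iota ℓ) ω = 0) :=
    fun F hF hFd => ih F.dim (by omega) (fun τ hτ => h τ (Simplex.le_trans hτ hF)) rfl
  subst hd
  have hσ := h σ (Simplex.le_refl σ)
  constructor
  · intro hc
    rcases lt_or_ge σ.dim k with hk | hk
    · exact Simplex.form_eq_zero_of_dim_lt hk _
    rw [dofs_of_lt hc hk] at hσ
    have hmem := Simplex.trace_mem σ (T.L σ) hω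
    -- The trace itself is the test object; it is a bubble because the induction hypothesis and
    -- `T.facet` kill its restriction to each facet.
    refine Simplex.eq_zero_of_l2Inner_self (T.isInner σ) hmem
      (hσ ⟨_, Simplex.mem_bubbleTensor hmem fun F hF hFd => ?_⟩)
    rw [Simplex.faceTrace_eq_zero_iff]
    intro x v
    exact T.facet F σ hF hFd hc _
      (Simplex.trace_eq_zero_iff.1 ((ih' F hF hFd).1 (by omega)) x v)
  · intro hc
    rw [dofs_of_le hc] at hσ
    have hmem := Simplex.trace_mem σ (σ.iota ℓ) hω
    refine Simplex.eq_zero_of_l2Inner_self σ.ipAlt_isInner hmem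
      (hσ ⟨_, Simplex.mem_bubble₂_iff.2 ⟨hmem, fun F hF hFd => ?_⟩⟩)
    rw [Simplex.faceTrace_eq_zero_iff]
    intro x v
    -- A facet below the threshold has dimension exactly `c - 1`, where `T.top` turns the low trace
    -- into the pullback.
    have key : F.iota ℓ (ω x fun i => v i) = 0 := by
      rcases lt_or_ge F.dim c with hFc | hFc
      · exact T.top F (by omega) _ (Simplex.trace_eq_zero_iff.1 ((ih' F hF hFd).1 hFc) x v)
      · exact Simplex.trace_eq_zero_iff.1 ((ih' F hF hFd).2 hFc) x v
    exact key

end LowTraces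

/-! ### Bilinearity of the degrees of freedom -/

section Bilinear

/-- The `L²` product is additive only on polynomial forms, so the bilinear map is built on
submodules whose images lie in a space `P` where additivity holds. -/
theorem exists_bilin_of_mem {M N : Type*} [AddCommMonoid M] [Module ℝ M] [AddCommMonoid N]
    [Module ℝ N] (S : Submodule ℝ M) {B P : Submodule ℝ N} (hB : B ≤ P) (tr : M →ₗ[ℝ] N)
    (htr : ∀ ω ∈ S, tr ω ∈ P) (f : N → N → ℝ)
    (add_left : ∀ x ∈ P, ∀ y ∈ P, ∀ z ∈ P, f (x + y) z = f x z + f y z)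
    (smul_left : ∀ (a : ℝ) (x z), f (a • x) z = a * f x z)
    (add_right : ∀ x ∈ P, ∀ y ∈ P, ∀ z ∈ P, f z (x + y) = f z x + f z y)
    (smul_right : ∀ (a : ℝ) (x z), f z (a • x) = a * f z x) :
    ∃ Φ : S →ₗ[ℝ] Module.Dual ℝ B, ∀ ω b, Φ ω b = f (tr ω) b := by
  refine ⟨LinearMap.mk₂ ℝ (fun (ω : S) (b : B) => f (tr ω) b) ?_ ?_ ?_ ?_, fun _ _ => rfl⟩
  · intro ω ω' b
    rw [Submodule.coe_add, map_add]
    exact add_left _ (htr _ ω.2) _ (htr _ ω'.2) _ (hB b.2)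
  · intro a ω b
    rw [Submodule.coe_smul, map_smul, smul_left, smul_eq_mul]
  · intro ω b b'
    exact add_right _ (hB b.2) _ (hB b'.2) _ (htr _ ω.2)
  · intro a ω b
    exact smul_right a _ _

/-- The functionals `D.val · b` are linear in both arguments on the subspace `V`. -/
def Dofs.Bilinear {M : Type} [AddCommMonoid M] [Module ℝ M] (D : Dofs M) (V : Submodule ℝ M) :
    Prop :=
  ∃ Φ : V →ₗ[ℝ] Module.Dual ℝ D.Test, ∀ ω b, Φ ω b = D.val ω b

theorem Dofs.Bilinear.val_add_smul {M : Type} [AddCommMonoid M] [Module ℝ M] {D : Dofs M}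
    {V : Submodule ℝ M} (h : D.Bilinear V) {ω ω' : M} (hω : ω ∈ V) (hω' : ω' ∈ V) (a : ℝ)
    (b : D.Test) : D.val (ω + a • ω') b = D.val ω b + a * D.val ω' b := by
  obtain ⟨Φ, hΦ⟩ := h
  rw [← hΦ ⟨ω, hω⟩, ← hΦ ⟨ω', hω'⟩, ← smul_eq_mul, ← LinearMap.smul_apply, ← LinearMap.add_apply,
    ← map_smul, ← map_add, hΦ]
  rfl

/-- Degrees of freedom are unisolvent if they separate the elements of `V` and are not more than
the dimension of `V`. -/
theorem unisolvent_of_finrank_le {n : ℕ} {M : Type} [AddCommGroup M] [Module ℝ M] {K : Simplex n}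
    {V : Submodule ℝ M} [Module.Finite ℝ V] {D : Simplex n → Dofs M}
    (hbil : ∀ σ, (D σ).Bilinear V) (hfin : ∀ σ, Module.Finite ℝ (D σ).Test)
    (hzero : ∀ ω ∈ V, (∀ σ : Simplex n, σ ≤ K → ∀ b, (D σ).val ω b = 0) → ω = 0)
    (hcard : ∑ σ : {σ : Simplex n // σ ≤ K}, Module.finrank ℝ (D σ).Test ≤ Module.finrank ℝ V) :
    Unisolvent K V D := by
  choose Φ hΦ using fun σ : {σ : Simplex n // σ ≤ K} => hbil σ
  have hinj : Function.Injective (LinearMap.pi Φ) := by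
    rw [← LinearMap.ker_eq_bot, LinearMap.ker_eq_bot']
    rintro ⟨ω, hω⟩ h
    refine Subtype.ext (hzero ω hω fun τ hτ b => ?_)
    rw [← hΦ ⟨τ, hτ⟩ ⟨ω, hω⟩ b]
    exact DFunLike.congr_fun (congrFun h ⟨τ, hτ⟩) b
  -- Injectivity gives one inequality and `hcard` the other; an injective map between spaces of
  -- equal dimension is surjective, which is existence.
  have hrank : Module.finrank ℝ V =
      Module.finrank ℝ (∀ σ : {σ : Simplex n // σ ≤ K}, Module.Dual ℝ (D σ).Test) := by
    refine le_antisymm (LinearMap.finrank_le_finrank_of_injective hinj) ?_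
    rw [Module.finrank_pi_fintype]
    refine le_trans (le_of_eq (Finset.sum_congr rfl fun σ _ => ?_)) hcard
    exact Subspace.dual_finrank_eq
  have hsurj := (LinearMap.injective_iff_surjective_of_finrank_eq_finrank hrank).1 hinj
  intro d
  obtain ⟨ω, hω⟩ := hsurj d
  refine ⟨ω, ⟨ω.2, fun σ b => ?_⟩, fun ω' ⟨hω', h'⟩ => ?_⟩
  · rw [← hΦ, ← hω]
    rfl
  · have : (⟨ω', hω'⟩ : V) = ω := hinj <| by
      rw [hω]
      funext σ
      ext b
      rw [LinearMap.pi_apply, hΦ, h']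
    exact congrArg Subtype.val this

variable {n k ℓ r : ℕ} {σ : Simplex n}

theorem Dofs.moments_bilin {W : Type} [AddCommGroup W] [Module ℝ W] [Module.Finite ℝ W]
    {ip : W → W → ℝ} (hip : IsInner ip) (L : (Eucl n [⋀^Fin ℓ]→ₗ[ℝ] ℝ) →ₗ[ℝ] W)
    {B : Submodule ℝ (σ.hull → σ.tan [⋀^Fin k]→ₗ[ℝ] W)} (hB : B ≤ prMinus σ.hull W r k) :
    (Dofs.moments σ ip L B).Bilinear (shape n k ℓ r) :=
  exists_bilin_of_mem (M := DForm n k ℓ) (shape n k ℓ r) hB (σ.trace L)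
    (fun _ hω => Simplex.trace_mem σ L hω)
    (σ.l2Inner ip) (fun _ hx _ hy _ hz => Simplex.l2Inner_add_left hip hx hy hz)
    (fun a _ _ => Simplex.l2Inner_smul_left hip a)
    (fun _ hx _ hy _ hz => Simplex.l2Inner_add_right hip hx hy hz)
    (fun a _ _ => Simplex.l2Inner_smul_right hip a)

theorem LowTraces.dofs_bilin {c : ℕ} (T : LowTraces n ℓ c) (k r : ℕ) (σ : Simplex n) :
    (T.dofs k r σ).Bilinear (shape n k ℓ r) := by
  rcases lt_or_ge σ.dim c with hc | hc
  · rcases lt_or_ge σ.dim k with hk | hk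
    · rw [dofs_of_lt_of_lt hc hk]
      exact ⟨0, fun _ _ => rfl⟩
    · rw [dofs_of_lt hc hk]
      exact Dofs.moments_bilin (T.isInner σ) _ Simplex.bubbleTensor_le
  · rw [dofs_of_le hc]
    exact Dofs.moments_bilin σ.ipAlt_isInner _ Simplex.bubble₂_le

theorem LowTraces.dofs_finite {c : ℕ} (T : LowTraces n ℓ c) (k r : ℕ) (σ : Simplex n) :
    Module.Finite ℝ (T.dofs k r σ).Test := by
  rcases lt_or_ge σ.dim c with hc | hc
  · rcases lt_or_ge σ.dim k with hk | hk
    · rw [dofs_of_lt_of_lt hc hk]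
      exact (inferInstance : Module.Finite ℝ PUnit)
    · rw [dofs_of_lt hc hk]
      exact (inferInstance : Module.Finite ℝ (σ.bubbleTensor r k (T.W σ)))
  · rw [dofs_of_le hc]
    exact (inferInstance : Module.Finite ℝ (σ.bubble₂ r k ℓ))

theorem trace_eq_of_add_neg_smul {W : Type} [AddCommGroup W] [Module ℝ W]
    {L : (Eucl n [⋀^Fin ℓ]→ₗ[ℝ] ℝ) →ₗ[ℝ] W} {ω ω' : DForm n k ℓ}
    (h : σ.trace L (ω + (-1 : ℝ) • ω') = 0) : σ.trace L ω = σ.trace L ω' := by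
  rwa [map_add, map_smul, neg_one_smul, add_neg_eq_zero] at h

/-- The traces of the elements of the resulting space are single-valued. -/
theorem LowTraces.singleValued {c : ℕ} (T : LowTraces n ℓ c)
    {𝒯 : Geometry.SimplicialComplex ℝ (Eucl n)} {ω : Cell 𝒯 → DForm n k ℓ}
    (hω : ω ∈ feSpace 𝒯 (shape n k ℓ r) (T.dofs k r)) (σ : Simplex n) :
    (σ.dim < c → SingleValued ω σ (T.W σ) (T.L σ)) ∧
      (c ≤ σ.dim → SingleValued ω σ (σ.tan [⋀^Fin ℓ]→ₗ[ℝ] ℝ) (σ.iota ℓ)) := by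
  -- The shape functions of both cells are polynomial forms on all of `ℝⁿ`, so their difference is a
  -- shape function, and all its degrees of freedom on the faces of the common face `σ` vanish.
  have key : ∀ K K' : Cell 𝒯, σ ≤ K.1 → σ ≤ K'.1 →
      (σ.dim < c → σ.trace (T.L σ) (ω K + (-1 : ℝ) • ω K') = 0) ∧
        (c ≤ σ.dim → σ.trace (σ.iota ℓ) (ω K + (-1 : ℝ) • ω K') = 0) := by
    intro K K' hK hK'
    refine trace_eq_zero (Submodule.add_mem _ (hω.1 K)
      (Submodule.smul_mem _ _ (hω.1 K'))) fun τ hτ b => ?_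
    rw [(T.dofs_bilin k r τ).val_add_smul (hω.1 K) (hω.1 K'), neg_one_mul,
      add_neg_eq_zero]
    exact hω.2 K K' τ (Simplex.le_trans hτ hK) (Simplex.le_trans hτ hK') b
  constructor
  · intro hc K K' hK hK'
    exact trace_eq_of_add_neg_smul ((key K K' hK hK').1 hc)
  · intro hc K K' hK hK'
    exact trace_eq_of_add_neg_smul ((key K K' hK hK').2 hc)

end Bilinear

/-! ### Unisolvence by counting dimensions -/

section Unisolvence

variable {n k ℓ r c : ℕ}

theorem Simplex.hull_eq_top {K : Simplex n} (hK : K.dim = n) : K.hull = ⊤ := by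
  refine (AffineSubspace.direction_eq_top_iff_of_nonempty ?_).1 ?_
  · exact K.nonempty.to_set.affineSpan ℝ
  · refine Submodule.eq_top_of_finrank_eq ?_
    rw [K.finrank_tan, hK]
    simp

theorem eq_zero_of_trace_iota_eq_zero {K : Simplex n} (hK : K.dim = n) {ω : DForm n k ℓ}
    (h : K.trace (K.iota ℓ) ω = 0) : ω = 0 := by
  rw [Simplex.trace_eq_zero_iff] at h
  have htan : ∀ v, v ∈ K.tan := fun v => by
    rw [Simplex.tan, Simplex.hull_eq_top hK, AffineSubspace.direction_top]
    trivial
  funext x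
  ext v u
  exact DFunLike.congr_fun (h ⟨x, by rw [Simplex.hull_eq_top hK]; trivial⟩
    fun i => ⟨v i, htan _⟩) fun i => ⟨u i, htan _⟩

instance : Module.Finite ℝ (shape n k ℓ r) := finite_of_le_prMinus (r := r) le_rfl

/-- On a full-dimensional simplex the pullback loses nothing, so `LowTraces.trace_eq_zero` at `K`
separates shape functions. The condition `hlow` covers the case that `K` itself lies below the
threshold. -/
theorem LowTraces.unisolvent (T : LowTraces n ℓ c) {K : Simplex n} (hK : K.dim = n)
    (hlow : K.dim < c → ∀ η, T.L K η = 0 → η = 0)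
    (hcard : ∑ σ : {σ : Simplex n // σ ≤ K}, Module.finrank ℝ (T.dofs k r σ).Test ≤
      Module.finrank ℝ (shape n k ℓ r)) :
    Unisolvent K (shape n k ℓ r) (T.dofs k r) := by
  refine unisolvent_of_finrank_le (T.dofs_bilin k r) (T.dofs_finite k r) (fun ω hω h => ?_) hcard
  have h0 := T.trace_eq_zero (σ := K) hω h
  rcases lt_or_ge K.dim c with hc | hc
  · refine eq_zero_of_trace_iota_eq_zero hK (Simplex.trace_eq_zero_iff.2 fun x v => ?_)
    rw [hlow hc _ (Simplex.trace_eq_zero_iff.1 (h0.1 hc) x v), map_zero]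
  · exact eq_zero_of_trace_iota_eq_zero hK (h0.2 hc)

end Unisolvence

/-! ### Extension of bubbles by zero -/

section Alternating

variable {V N : Type*} [AddCommGroup V] [Module ℝ V] [AddCommGroup N] [Module ℝ N]

theorem map_vecCons_eq_zero {k : ℕ} (β : V [⋀^Fin (k + 1)]→ₗ[ℝ] N) (p : V) (v : Fin k → V)
    (i : Fin k) (c : ℝ) (h : v i = c • p) : β (Matrix.vecCons p v) = 0 := by
  have h1 : Matrix.vecCons p v = Function.update (Matrix.vecCons p v) i.succ (c • p) := by
    rw [← h, eq_comm, Function.update_eq_self_iff]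
    rfl
  rw [h1, AlternatingMap.map_update_smul, AlternatingMap.map_eq_zero_of_eq _ _ (i := 0)
    (j := i.succ) _ (Fin.succ_ne_zero i).symm, smul_zero]
  rw [Function.update_self, Function.update_of_ne (Fin.succ_ne_zero i).symm]
  rfl

/-- Multiples of the first argument may be added to the other arguments of an alternating map. -/
theorem map_vecCons_add_smul {k : ℕ} (β : V [⋀^Fin (k + 1)]→ₗ[ℝ] N) (p : V) (v : Fin k → V)
    (c : Fin k → ℝ) : β (Matrix.vecCons p (v + fun i => c i • p)) = β (Matrix.vecCons p v) := by
  have h := (β.curryLeft p).toMultilinearMap.map_add_univ v fun i => c i • p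
  simp only [AlternatingMap.coe_multilinearMap, AlternatingMap.curryLeft_apply_apply] at h
  -- In the multilinear expansion every other term has a multiple of `p` in a second slot.
  rw [h, Finset.sum_eq_single Finset.univ]
  · simp
  · intro s _ hs
    obtain ⟨i, hi⟩ : ∃ i, i ∉ s := by
      by_contra! hall
      exact hs (Finset.eq_univ_of_forall hall)
    exact map_vecCons_eq_zero β p _ i (c i) (by simp [hi])
  · simp

/-- The exterior product of the first coordinate with a form in the second coordinate. -/
theorem exists_fst_wedge {k : ℕ} (η : V [⋀^Fin k]→ₗ[ℝ] N) :
    ∃ β : (ℝ × V) [⋀^Fin (k + 1)]→ₗ[ℝ] N, ∀ (y : V) (u : Fin k → V),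
      β (Matrix.vecCons ((1 : ℝ), y) fun i => ((0 : ℝ), u i)) = η u := by
  refine ⟨AlternatingMap.alternatizeUncurryFin ((LinearMap.fst ℝ ℝ V).smulRight
    (η.compLinearMap (LinearMap.snd ℝ ℝ V))), fun y u => ?_⟩
  -- Only the term that feeds the first vector to the coordinate survives, the other vectors having
  -- first coordinate zero.
  rw [AlternatingMap.alternatizeUncurryFin_apply, Fin.sum_univ_succ, Finset.sum_eq_zero]
  · simp
  · intro i _
    simp

end Alternating

section Bary

variable {n : ℕ}

theorem affineMap_sum_apply {ι P E : Type*} [AddTorsor (Eucl n) P] [AddCommGroup E] [Module ℝ E]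
    (s : Finset ι) (f : ι → (P →ᵃ[ℝ] E)) (x : P) : (∑ i ∈ s, f i) x = ∑ i ∈ s, f i x :=
  map_sum (AddMonoidHom.mk (⟨fun f : P →ᵃ[ℝ] E => f x, rfl⟩) fun _ _ => rfl) f s

/-- An affine map with prescribed values at the vertices of an `n`-simplex in `ℝⁿ`. -/
theorem exists_affineMap_verts {E : Type*} [AddCommGroup E] [Module ℝ E] {K : Simplex n}
    (hK : K.dim = n) (φ : Eucl n → E) : ∃ A : Eucl n →ᵃ[ℝ] E, ∀ w ∈ K.verts, A w = φ w := by
  classical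
  let b : AffineBasis K.verts ℝ (Eucl n) :=
    ⟨(↑), K.indep, by rw [Subtype.range_coe]; exact Simplex.hull_eq_top hK⟩
  refine ⟨∑ v : K.verts, (LinearMap.toSpanSingleton ℝ E (φ v)).toAffineMap.comp (b.coord v),
    fun w hw => ?_⟩
  have h (v : K.verts) : b.coord v w = if v = ⟨w, hw⟩ then 1 else 0 := b.coord_apply v ⟨w, hw⟩
  simp [affineMap_sum_apply, h, ite_smul]

theorem affineMap_eq_on_hull {E : Type*} [AddCommGroup E] [Module ℝ E] {σ : Simplex n}
    {f g : Eucl n →ᵃ[ℝ] E} (h : ∀ w ∈ σ.verts, f w = g w) {x : Eucl n} (hx : x ∈ σ.hull) :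
    f x = g x := by
  refine affineSpan_induction hx (p := fun x => f x = g x) (fun w hw => h w hw) ?_
  intro c u v w hu hv hw
  simp only [AffineMap.map_vadd, LinearMap.map_smul, AffineMap.linearMap_vsub, hu, hv, hw]

theorem affineMap_linear_eq_on_tan {E : Type*} [AddCommGroup E] [Module ℝ E] {σ : Simplex n}
    {f g : Eucl n →ᵃ[ℝ] E} (h : ∀ w ∈ σ.verts, f w = g w) {v : Eucl n} (hv : v ∈ σ.tan) :
    f.linear v = g.linear v := by
  obtain ⟨w, hw⟩ := σ.nonempty
  have hw' := Simplex.vert_mem_hull hw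
  have hx := AffineSubspace.vadd_mem_of_mem_direction hv hw'
  have h1 := affineMap_eq_on_hull h hx
  rw [AffineMap.map_vadd, AffineMap.map_vadd, h w hw] at h1
  exact vadd_right_cancel _ h1

end Bary

/-! ### Homogenization and the extension of bubbles -/

section Homogeneous

variable {n k r : ℕ} {τ : Simplex n} {W : Type} [AddCommGroup W] [Module ℝ W]

/-- The form `ω` on `ℝⁿ` is the pullback of the homogeneous form of degree `r` that is given by the
form `b` on `τ`, under the affine map `A` to the space `ℝ × ℝⁿ` of homogeneous coordinates. -/
structure IsHomogeneousPullback (r : ℕ) (A : Eucl n →ᵃ[ℝ] ℝ × Eucl n)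
    (b : τ.hull → τ.tan [⋀^Fin k]→ₗ[ℝ] W) (ω : Eucl n → Eucl n [⋀^Fin k]→ₗ[ℝ] W) : Prop where
  -- The point `A x` lies on the line through `(1, y)`, and the vectors agree with `u` modulo that
  -- radial direction, which the homogeneous form annihilates; the weight `(A x).1` enters with the
  -- degree `r`.
  apply_eq : ∀ (x : Eucl n) (y : τ.hull) (v : Fin k → Eucl n) (u : Fin k → τ.tan),
    A x = (A x).1 • ((1 : ℝ), (y : Eucl n)) →
    (∀ i, A.linear (v i) = ((0 : ℝ), (u i : Eucl n)) + (A.linear (v i)).1 • ((1 : ℝ), (y : Eucl n))) →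
    ω x v = (A x).1 ^ r • b y u
  eq_zero : ∀ x, A x = 0 → ω x = 0

/-- Contracting a constant form `β` with the position vector gives a form of degree one that
annihilates the radial direction, and `r - 1` homogenized affine factors raise the degree to `r`.
Pulling back by an affine map stays in `𝒫_r⁻`. -/
theorem exists_isHomogeneousPullback_of_form (hr : 1 ≤ r) (A : Eucl n →ᵃ[ℝ] ℝ × Eucl n)
    (f : Fin (r - 1) → (τ.hull →ᵃ[ℝ] ℝ)) (β : (ℝ × Eucl n) [⋀^Fin (k + 1)]→ₗ[ℝ] W)
    {b : τ.hull → τ.tan [⋀^Fin k]→ₗ[ℝ] W}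
    (hb : ∀ y u, b y u = (∏ i, f i y) •
      β (Matrix.vecCons ((1 : ℝ), (y : Eucl n)) fun i => ((0 : ℝ), (u i : Eucl n)))) :
    ∃ ω ∈ prMinus (Eucl n) W r k, IsHomogeneousPullback r A b ω := by
  obtain ⟨p, hp⟩ := τ.tan.subtype.exists_leftInverse_of_injective (Submodule.ker_subtype _)
  have hp' : ∀ u : τ.tan, p u = u := fun u => LinearMap.congr_fun hp u
  obtain ⟨a⟩ := (inferInstance : Nonempty τ.hull)
  -- The homogenization of `f i`: its constant term is multiplied by the first coordinate. The
  -- projection `p` extends the linear part from the tangent space of `τ` to `ℝⁿ`.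
  let g : Fin (r - 1) → (Eucl n →ᵃ[ℝ] ℝ) := fun i =>
    (((f i a - (f i).linear (p a)) • LinearMap.fst ℝ ℝ (Eucl n) +
      (f i).linear ∘ₗ p ∘ₗ LinearMap.snd ℝ ℝ (Eucl n)).toAffineMap).comp A
  have hf : ∀ i (y : τ.hull), f i y = f i a - (f i).linear (p a) + (f i).linear (p y) := by
    intro i y
    have h1 : (f i).linear (y -ᵥ a) = f i y - f i a := AffineMap.linearMap_vsub _ _ _
    have h2 : p y - p a = y -ᵥ a := by rw [← map_sub]; exact hp' (y -ᵥ a)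
    rw [← h2, map_sub] at h1
    linarith
  have hg : ∀ i x (y : τ.hull), A x = (A x).1 • ((1 : ℝ), (y : Eucl n)) →
      g i x = (A x).1 * f i y := by
    intro i x y hxy
    have h2 : (A x).2 = (A x).1 • (y : Eucl n) := congrArg Prod.snd hxy
    simp only [g, AffineMap.comp_apply, LinearMap.coe_toAffineMap, LinearMap.add_apply,
      LinearMap.smul_apply, LinearMap.comp_apply, LinearMap.fst_apply, LinearMap.snd_apply, h2, hf i y,
      map_smul, smul_eq_mul]
    ring
  let ω : Eucl n → Eucl n [⋀^Fin k]→ₗ[ℝ] W := fun x =>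
    (∏ i, g i x) • (β.curryLeft (A x)).compLinearMap A.linear
  have hω : ω ∈ prMinus (Eucl n) W r k := by
    -- Splitting `A x` into `A 0` and its linear part separates a term with polynomial coefficients
    -- of degree at most `r - 1` from a Koszul term with base point `0`.
    have h : ω = (fun x => (∏ i, g i x) • (β.curryLeft (A 0)).compLinearMap A.linear) +
        fun x => (∏ i, g i x) • (β.compLinearMap A.linear).curryLeft (x -ᵥ 0) := by
      funext x
      have hx : A x = A 0 + A.linear (x -ᵥ 0) := by
        rw [AffineMap.linearMap_vsub]
        simp
      simp only [ω, Pi.add_apply, hx, map_add, ← smul_add]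
      congr 1
      ext v
      simp only [AlternatingMap.compLinearMap_apply, AlternatingMap.add_apply,
        AlternatingMap.curryLeft_apply_apply]
      congr 2
      funext i
      refine Fin.cases ?_ (fun i => ?_) i <;> simp
    rw [h]
    exact Submodule.add_mem _ (prMinus_mem_const g _) (prMinus_mem_koszul 0 g _)
  refine ⟨ω, hω, ⟨fun x y v u hx hv => ?_, fun x hx => ?_⟩⟩
  · have hprod : ∏ i, g i x = (A x).1 ^ (r - 1) * ∏ i, f i y := by
      rw [Finset.prod_congr rfl fun i _ => hg i x y hx, Finset.prod_mul_distrib, Finset.prod_const,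
        Finset.card_univ, Fintype.card_fin]
    have hβ : β.curryLeft (A x) (fun i => A.linear (v i)) = (A x).1 •
        β (Matrix.vecCons ((1 : ℝ), (y : Eucl n)) fun i => ((0 : ℝ), (u i : Eucl n))) := by
      rw [← map_vecCons_add_smul β _ _ fun i => (A.linear (v i)).1]
      conv_lhs => rw [hx, map_smul]
      rw [AlternatingMap.smul_apply, AlternatingMap.curryLeft_apply_apply]
      congr 3
      funext i
      exact hv i
    have : ω x v = (∏ i, g i x) • β.curryLeft (A x) (fun i => A.linear (v i)) := rfl
    rw [this, hβ, hprod, hb, smul_smul, smul_smul]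
    congr 1
    have hpow : (A x).1 ^ r = (A x).1 ^ (r - 1) * (A x).1 := by
      rw [← pow_succ, Nat.sub_add_cancel hr]
    rw [hpow]
    ring
  · ext v
    change (∏ i, g i x) • β.curryLeft (A x) (fun i => A.linear (v i)) = 0
    rw [hx, map_zero]
    simp

theorem exists_isHomogeneousPullback (hr : 1 ≤ r) (A : Eucl n →ᵃ[ℝ] ℝ × Eucl n)
    {b : τ.hull → τ.tan [⋀^Fin k]→ₗ[ℝ] W} (hb : b ∈ prMinus τ.hull W r k) :
    ∃ ω ∈ prMinus (Eucl n) W r k, IsHomogeneousPullback r A b ω := by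
  obtain ⟨p, hp⟩ := τ.tan.subtype.exists_leftInverse_of_injective (Submodule.ker_subtype _)
  have hp' : ∀ u : τ.tan, p u = u := fun u => LinearMap.congr_fun hp u
  obtain ⟨a⟩ := (inferInstance : Nonempty τ.hull)
  let S : Submodule ℝ (τ.hull → τ.tan [⋀^Fin k]→ₗ[ℝ] W) :=
    { carrier := {b | ∃ ω ∈ prMinus (Eucl n) W r k, IsHomogeneousPullback r A b ω}
      add_mem' := by
        rintro b b' ⟨ω, hω, h⟩ ⟨ω', hω', h'⟩
        refine ⟨ω + ω', Submodule.add_mem _ hω hω', ⟨fun x y v u hx hv => ?_, fun x hx => ?_⟩⟩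
        · simp only [Pi.add_apply, AlternatingMap.add_apply, h.apply_eq x y v u hx hv,
            h'.apply_eq x y v u hx hv, smul_add]
        · rw [Pi.add_apply, h.eq_zero x hx, h'.eq_zero x hx, add_zero]
      zero_mem' := ⟨0, Submodule.zero_mem _, ⟨fun x y v u _ _ => by simp, fun x _ => rfl⟩⟩
      smul_mem' := by
        rintro c b ⟨ω, hω, h⟩
        refine ⟨c • ω, Submodule.smul_mem _ c hω, ⟨fun x y v u hx hv => ?_, fun x hx => ?_⟩⟩
        · simp only [Pi.smul_apply, AlternatingMap.smul_apply, h.apply_eq x y v u hx hv]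
          rw [smul_comm]
        · rw [Pi.smul_apply, h.eq_zero x hx, smul_zero] }
  refine (prMinus_le (S := S) a (fun f η => ?_) fun f η => ?_) hb
  -- A constant form is the contraction of its exterior product with the differential of the first
  -- coordinate.
  · obtain ⟨β, hβ⟩ := exists_fst_wedge (η.compLinearMap p)
    refine exists_isHomogeneousPullback_of_form hr A f β fun y u => ?_
    rw [hβ]
    simp [hp']
  -- The map `(s, y) ↦ p (y - s • a)` sends `(1, y)` to `y -ᵥ a` and `(0, u)` to `u`, which
  -- reproduces the Koszul term.
  · refine exists_isHomogeneousPullback_of_form hr A f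
      (η.compLinearMap (p ∘ₗ (LinearMap.snd ℝ ℝ (Eucl n) -
        (LinearMap.fst ℝ ℝ (Eucl n)).smulRight (a : Eucl n)))) fun y u => ?_
    simp only [AlternatingMap.smul_apply, AlternatingMap.curryLeft_apply_apply,
      AlternatingMap.compLinearMap_apply]
    congr 2
    funext i
    refine Fin.cases ?_ (fun i => ?_) i
    · exact (by simpa using (hp' (y -ᵥ a)).symm)
    · simp [hp']

/-- A bubble on a face of an `n`-simplex extends to a form on `ℝⁿ` whose traces vanish on all
faces that do not contain the given one. -/
theorem exists_extension (hr : 1 ≤ r) {K : Simplex n} (hK : K.dim = n) (hτ : τ ≤ K)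
    {b : τ.hull → τ.tan [⋀^Fin k]→ₗ[ℝ] W} (hb : b ∈ prMinus τ.hull W r k)
    (hbF : ∀ (F : Simplex n) (h : F ≤ τ), F.dim + 1 = τ.dim →
      Simplex.faceTrace h (LinearMap.id : W →ₗ[ℝ] W) b = 0) :
    ∃ ω ∈ prMinus (Eucl n) W r k,
      (∀ (x : τ.hull) (v : Fin k → τ.tan), ω x (fun i => v i) = b x v) ∧
      ∀ τ' : Simplex n, τ' ≤ K → ¬ τ ≤ τ' →
        ∀ (x : τ'.hull) (v : Fin k → τ'.tan), ω x (fun i => v i) = 0 := by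
  classical
  -- The first component of `A` is the sum of the barycentric coordinates belonging to `τ`. On `τ`
  -- it is `1` and the second component is the identity.
  obtain ⟨A, hA⟩ := exists_affineMap_verts hK
    fun w => if w ∈ τ.verts then ((1 : ℝ), w) else (0 : ℝ × Eucl n)
  obtain ⟨ω, hω, h⟩ := exists_isHomogeneousPullback hr A hb
  refine ⟨ω, hω, fun x v => ?_, fun τ' hτ' hnot x v => ?_⟩
  · let G : Eucl n →ᵃ[ℝ] ℝ × Eucl n := (AffineMap.const ℝ (Eucl n) (1 : ℝ)).prod (AffineMap.id ℝ _)
    have hAG : ∀ w ∈ τ.verts, A w = G w := fun w hw => by rw [hA w (hτ hw), if_pos hw]; rfl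
    have hx : A x = (1, (x : Eucl n)) := affineMap_eq_on_hull hAG x.2
    have hv : ∀ i, A.linear (v i) = (0, (v i : Eucl n)) := fun i =>
      affineMap_linear_eq_on_tan hAG (v i).2
    have := h.apply_eq x x (fun i => v i) v (by simp [hx]) (by simp [hv])
    rw [this, hx, one_pow, one_smul]
  · obtain ⟨w, hw, hw'⟩ : ∃ w ∈ τ.verts, w ∉ τ'.verts := Finset.not_subset.1 hnot
    by_cases hdis : ∃ z ∈ τ'.verts, z ∈ τ.verts
    · obtain ⟨z, hz', hz⟩ := hdis
      have hzw : z ≠ w := fun h => hw' (h ▸ hz')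
      -- All vertices that `τ'` shares with `τ` lie in the facet `F` opposite to the missing vertex
      -- `w`.
      obtain ⟨F, hF, hFd, hFv⟩ := Simplex.exists_facet hw ⟨z, Finset.mem_erase.2 ⟨hzw, hz⟩⟩
      have hzF : z ∈ F.verts := by rw [hFv]; exact Finset.mem_erase.2 ⟨hzw, hz⟩
      -- The kernel of `q` is the linear span of `{1} × F.hull`; since `A` maps the vertices of `τ'`
      -- into it, it maps all of `τ'.hull` and its tangent vectors there.
      let q : ℝ × Eucl n →ₗ[ℝ] Eucl n ⧸ F.tan := F.tan.mkQ ∘ₗ (LinearMap.snd ℝ ℝ (Eucl n) -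
        (LinearMap.fst ℝ ℝ (Eucl n)).smulRight z)
      have hqmem : ∀ y, q y = 0 ↔ y.2 - y.1 • z ∈ F.tan := fun y =>
        Submodule.Quotient.mk_eq_zero _
      have hq : ∀ y ∈ τ'.verts, q.toAffineMap.comp A y =
          AffineMap.const ℝ (Eucl n) (0 : Eucl n ⧸ F.tan) y := by
        intro y hy
        rw [AffineMap.comp_apply, hA y (hτ' hy), AffineMap.const_apply]
        split_ifs with hyτ
        · have hyF : y ∈ F.verts := by
            rw [hFv]
            exact Finset.mem_erase.2 ⟨fun h => hw' (h ▸ hy), hyτ⟩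
          refine (hqmem _).2 ?_
          rw [one_smul]
          exact Simplex.sub_mem_tan hyF hzF
        · simp
      have hpt : ∀ y ∈ τ'.hull, (A y).2 - (A y).1 • z ∈ F.tan := fun y hy =>
        (hqmem _).1 (affineMap_eq_on_hull hq hy)
      have hvec : ∀ u ∈ τ'.tan, (A.linear u).2 - (A.linear u).1 • z ∈ F.tan := fun u hu =>
        (hqmem _).1 (affineMap_linear_eq_on_tan hq hu)
      -- Where the weight is nonzero, dividing by it gives a point `y'` of `F.hull`, and `ω` is a
      -- multiple of the trace of `b` on `F`, which vanishes.
      have hzero : ∀ y ∈ τ'.hull, (A y).1 ≠ 0 → ω y (fun i => v i) = 0 := by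
        intro y hy hs
        let d : F.tan := ⟨_, F.tan.smul_mem (A y).1⁻¹ (hpt y hy)⟩
        let y' : F.hull := d +ᵥ (⟨z, Simplex.vert_mem_hull hzF⟩ : F.hull)
        have hy' : (y' : Eucl n) = (A y).1⁻¹ • (A y).2 := by
          change (A y).1⁻¹ • ((A y).2 - (A y).1 • z) + z = _
          rw [smul_sub, inv_smul_smul₀ hs, sub_add_cancel]
        have hu : ∀ i, (A.linear (v i)).2 - (A.linear (v i)).1 • (y' : Eucl n) ∈ F.tan := by
          intro i
          have h1 := hvec _ (v i).2
          have h2 := F.tan.smul_mem (A.linear (v i)).1 d.2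
          have h3 : (y' : Eucl n) = d + z := rfl
          have h4 := F.tan.sub_mem h1 h2
          rwa [sub_sub, ← smul_add, add_comm z, ← h3] at h4
        have := h.apply_eq y (Set.inclusion (Simplex.hull_mono hF) y') (fun i => v i)
          (fun i => Simplex.tanIncl hF ⟨_, hu i⟩) ?_ fun i => ?_
        · rw [this]
          have h0 := Simplex.faceTrace_eq_zero_iff.1 (hbF F hF hFd) y' fun i => ⟨_, hu i⟩
          rw [LinearMap.id_apply] at h0
          rw [h0, smul_zero]
        · refine Prod.ext (by simp) ?_
          change (A y).2 = (A y).1 • (y' : Eucl n)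
          rw [hy', smul_inv_smul₀ hs]
        · refine Prod.ext (by simp) ?_
          change (A.linear (v i)).2 = (A.linear (v i)).2 - (A.linear (v i)).1 • (y' : Eucl n) +
            (A.linear (v i)).1 • (y' : Eucl n)
          rw [sub_add_cancel]
      -- At weight zero the division fails. On the line from `x` to the shared vertex `z` the weight
      -- is the parameter `t`, so the coefficients vanish for `t ≠ 0` and, being polynomial, also at
      -- `t = 0`.
      by_cases hs : (A x).1 = 0
      · have hz1 : (A z).1 = 1 := by rw [hA z (hτ' hz'), if_pos hz]
        have hline : ∀ t : ℝ, (A (AffineMap.lineMap (x : Eucl n) z t)).1 = t := by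
          intro t
          rw [AffineMap.apply_lineMap, AffineMap.lineMap_apply_module]
          simp [hs, hz1]
        rw [← Module.forall_dual_apply_eq_zero_iff ℝ]
        intro φ
        have hpoly := prMinus_coeff_mem_polyFun hω φ fun i => (v i : Eucl n)
        have := polyFun_lineMap_eq_zero hpoly (x : Eucl n) z (s := {0}ᶜ)
          (Set.finite_singleton _).infinite_compl (fun t ht => ?_) 0
        · simpa using this
        · rw [hzero _ (AffineMap.lineMap_mem _ x.2 (Simplex.vert_mem_hull hz')) (by rwa [hline]),
            map_zero]
      · exact hzero x x.2 hs
    · push Not at hdis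
      have hA0 : A x = 0 := affineMap_eq_on_hull (g := AffineMap.const ℝ (Eucl n) 0)
        (fun y hy => by rw [hA y (hτ' hy), if_neg (hdis y hy)]; rfl) x.2
      rw [h.eq_zero x hA0]
      rfl

end Homogeneous

/-! ### Lower bounds for the dimension of the shape space -/

section Dimension

/-- A triangular system of subspaces: if each element of `B i` lifts to an element of `M` that
vanishes under the other maps of at most the same rank, the dimensions add up to at most that
of `M`. -/
theorem sum_finrank_le_of_lift {ι : Type*} [Fintype ι] (rk : ι → ℕ) {M : Type*} [AddCommGroup M]
    [Module ℝ M] [Module.Finite ℝ M] {N : ι → Type*} [∀ i, AddCommGroup (N i)]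
    [∀ i, Module ℝ (N i)] (B : ∀ i, Submodule ℝ (N i)) [∀ i, Module.Finite ℝ (B i)]
    (tr : ∀ i, M →ₗ[ℝ] N i)
    (h : ∀ i, ∀ b ∈ B i, ∃ m, tr i m = b ∧ ∀ j, j ≠ i → rk j ≤ rk i → tr j m = 0) :
    ∑ i, Module.finrank ℝ (B i) ≤ Module.finrank ℝ M := by
  classical
  have hE : ∀ i, ∃ E : B i →ₗ[ℝ] M, (∀ b : B i, tr i (E b) = b) ∧
      ∀ j, j ≠ i → rk j ≤ rk i → ∀ b : B i, tr j (E b) = 0 := by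
    intro i
    let e := Module.finBasis ℝ (B i)
    choose m hm hm' using fun s => h i (e s) (e s).2
    refine ⟨e.constr ℝ m, fun b => ?_, fun j hj hij b => ?_⟩
    · have : tr i ∘ₗ e.constr ℝ m = (B i).subtype := e.ext fun s => by simp [hm]
      exact LinearMap.congr_fun this b
    · have : tr j ∘ₗ e.constr ℝ m = 0 := e.ext fun s => by simp [hm' s j hj hij]
      exact LinearMap.congr_fun this b
  choose E hE hE' using hE
  let Θ : (∀ i, B i) →ₗ[ℝ] M := ∑ i, E i ∘ₗ LinearMap.proj i
  have hinj : Function.Injective Θ := by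
    rw [← LinearMap.ker_eq_bot, LinearMap.ker_eq_bot']
    intro b hb
    -- In `tr i (Θ b)` the indices of smaller rank contribute nothing by induction, and the other
    -- indices `j ≠ i` contribute nothing because `tr i` kills their lifts; only `b i` remains.
    have key : ∀ d i, rk i = d → b i = 0 := by
      intro d
      induction d using Nat.strong_induction_on with
      | _ d ih =>
      intro i hi
      have h0 : tr i (Θ b) = b i := by
        simp only [Θ, LinearMap.sum_apply, LinearMap.comp_apply, LinearMap.proj_apply, map_sum]
        rw [Finset.sum_eq_single i]
        · exact hE i (b i)
        · intro j _ hj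
          rcases lt_or_ge (rk j) (rk i) with hlt | hge
          · rw [ih (rk j) (hi ▸ hlt) j rfl, map_zero, map_zero]
          · exact hE' j i hj.symm hge (b j)
        · simp
      rw [hb, map_zero] at h0
      exact Subtype.ext h0.symm
    funext i
    exact key _ i rfl
  calc ∑ i, Module.finrank ℝ (B i) = Module.finrank ℝ (∀ i, B i) :=
        (Module.finrank_pi_fintype ℝ).symm
    _ ≤ _ := LinearMap.finrank_le_finrank_of_injective hinj

variable {n k r : ℕ}

/-- The extension of a bubble has zero trace on faces not containing `τ`, in particular on every
other face of at most the same dimension, so the faces ordered by dimension form a triangular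
system. -/
theorem sum_finrank_bubble_le (hr : 1 ≤ r) {K : Simplex n} (hK : K.dim = n) :
    ∑ τ : {τ : Simplex n // τ ≤ K}, Module.finrank ℝ (τ.1.bubble r k) ≤
      Module.finrank ℝ (prMinus (Eucl n) ℝ r k) := by
  refine sum_finrank_le_of_lift (M := prMinus (Eucl n) ℝ r k) (fun τ => τ.1.dim)
    (fun τ : {τ : Simplex n // τ ≤ K} => τ.1.bubble r k)
    (fun τ => pullback (fun x : τ.1.hull => (x : Eucl n)) τ.1.tan.subtype LinearMap.id ∘ₗ
      (prMinus (Eucl n) ℝ r k).subtype) fun τ b hb => ?_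
  obtain ⟨hb1, hb2⟩ := Simplex.mem_bubble_iff.1 hb
  obtain ⟨ω, hω, h1, h2⟩ := exists_extension hr hK τ.2 hb1 hb2
  refine ⟨⟨ω, hω⟩, ?_, fun τ' hne hd => ?_⟩
  · funext x
    ext v
    exact h1 x v
  · funext x
    ext v
    exact h2 τ' τ'.2 (fun hle => hne (Subtype.ext (Simplex.eq_of_le_of_dim_eq hle
      (le_antisymm (Simplex.dim_le_of_le hle) hd)).symm)) x v

theorem finrank_prMinus_mul_le (X : Type*) {V W : Type*} [AddCommGroup V] [Module ℝ V]
    [Module.Finite ℝ V] [AddTorsor V X] [AddCommGroup W] [Module ℝ W] [Module.Finite ℝ W]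
    (r k : ℕ) : Module.finrank ℝ (prMinus X (V := V) ℝ r k) * Module.finrank ℝ W ≤
      Module.finrank ℝ (prMinus X (V := V) W r k) := by
  let e := Module.finBasis ℝ W
  let T : (Fin (Module.finrank ℝ W) → prMinus X (V := V) ℝ r k) →ₗ[ℝ]
      (X → V [⋀^Fin k]→ₗ[ℝ] W) :=
    ∑ i, pullback id LinearMap.id (LinearMap.toSpanSingleton ℝ W (e i)) ∘ₗ
      (prMinus X (V := V) ℝ r k).subtype ∘ₗ LinearMap.proj i
  have hT : ∀ b x v, T b x v = ∑ i, (b i).1 x v • e i := by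
    intro b x v
    simp only [T, LinearMap.sum_apply, Finset.sum_apply, alternatingMap_sum_apply]
    rfl
  have hmem : ∀ b, T b ∈ prMinus X (V := V) W r k := by
    intro b
    simp only [T, LinearMap.sum_apply]
    exact Submodule.sum_mem _ fun i _ => pullback_mem_prMinus (AffineMap.id ℝ X) _ (b i).2
  have hinj : Function.Injective (T.codRestrict _ hmem) := by
    intro b b' hb
    have hb0 : T b = T b' := congrArg Subtype.val hb
    funext i
    refine Subtype.ext ?_
    funext x
    ext v
    have h0 := hT b x v
    rw [hb0, hT] at h0
    have h1 := congrArg (fun w => e.repr w i) h0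
    simp only [e.repr_sum_self] at h1
    exact h1.symm
  have hfree := free_submodule_forms (prMinus X (V := V) ℝ r k)
  calc _ = Module.finrank ℝ (Fin (Module.finrank ℝ W) → prMinus X (V := V) ℝ r k) := by
        rw [Module.finrank_pi_fintype, Finset.sum_const, Finset.card_univ, Fintype.card_fin,
          smul_eq_mul, mul_comm]
    _ ≤ _ := LinearMap.finrank_le_finrank_of_injective hinj

end Dimension

/-! ### The dimension of the double bubbles -/

section Enumeration

variable {α : Type*} [Inhabited α] {ℓ : ℕ}

/-- An enumeration of a finite set with `ℓ` elements. -/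
def enum (ℓ : ℕ) (I : Finset α) : Fin ℓ → α :=
  if h : I.card = ℓ then fun i => (I.equivFinOfCardEq h).symm i else fun _ => default

theorem enum_mem {I : Finset α} (h : I.card = ℓ) (i : Fin ℓ) : enum ℓ I i ∈ I := by
  rw [enum, dif_pos h]
  exact Subtype.mem _

/-- An injective family is an enumeration of its image, up to a permutation. -/
theorem exists_perm_enum [DecidableEq α] {v : Fin ℓ → α} (hv : Function.Injective v) :
    ∃ π : Equiv.Perm (Fin ℓ), v = enum ℓ (Finset.univ.image v) ∘ π := by
  have hcard : (Finset.univ.image v).card = ℓ := by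
    rw [Finset.card_image_of_injective _ hv, Finset.card_univ, Fintype.card_fin]
  have hbij : Function.Bijective fun i : Fin ℓ =>
      (⟨v i, Finset.mem_image_of_mem v (Finset.mem_univ i)⟩ : Finset.univ.image v) := by
    refine ⟨fun i j h => hv (congrArg Subtype.val h), ?_⟩
    rintro ⟨x, hx⟩
    obtain ⟨i, -, rfl⟩ := Finset.mem_image.1 hx
    exact ⟨i, rfl⟩
  refine ⟨(Equiv.ofBijective _ hbij).trans (Finset.equivFinOfCardEq hcard), ?_⟩
  funext i
  simp [enum, dif_pos hcard]

end Enumeration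

namespace Simplex

variable {n : ℕ} {σ τ : Simplex n} {k ℓ r : ℕ}

/-- The tangent vector from the vertex `v` to the vertex `w`. -/
def edge (σ : Simplex n) (v w : Eucl n) : σ.tan :=
  open Classical in if h : w - v ∈ σ.tan then ⟨w - v, h⟩ else 0

theorem coe_edge {v w : Eucl n} (hv : v ∈ σ.verts) (hw : w ∈ σ.verts) :
    (σ.edge v w : Eucl n) = w - v := by
  rw [edge, dif_pos (sub_mem_tan hw hv)]

/-- An alternating form is determined by its values on the edges at a vertex. -/
theorem alternating_eq_zero {W : Type*} [AddCommGroup W] [Module ℝ W] {v : Eucl n}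
    (hv : v ∈ σ.verts) (η : σ.tan [⋀^Fin ℓ]→ₗ[ℝ] W)
    (h : ∀ I ∈ (σ.verts.erase v).powersetCard ℓ, η (fun i => σ.edge v (enum ℓ I i)) = 0) :
    η = 0 := by
  classical
  have hli : LinearIndependent ℝ fun x : {x : σ.verts // x ≠ ⟨v, hv⟩} => σ.edge v x.1 := by
    refine LinearIndependent.of_comp σ.tan.subtype ?_
    have := (affineIndependent_iff_linearIndependent_vsub ℝ _ (⟨v, hv⟩ : σ.verts)).1 σ.indep
    have hfun : (σ.tan.subtype ∘ fun x : {x : σ.verts // x ≠ ⟨v, hv⟩} => σ.edge v x.1) =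
        fun x : {x : σ.verts // x ≠ ⟨v, hv⟩} => (x.1.1 -ᵥ v : Eucl n) :=
      funext fun x => coe_edge hv x.1.2
    rw [hfun]
    exact this
  have hcard : Fintype.card {x : σ.verts // x ≠ ⟨v, hv⟩} = Module.finrank ℝ σ.tan := by
    rw [finrank_tan, Fintype.card_subtype_compl, Fintype.card_coe, card_verts]
    simp
  let e : Module.Basis {x : σ.verts // x ≠ ⟨v, hv⟩} ℝ σ.tan := by
    -- The edges are a basis by a dimension count; a simplex with one vertex, whose tangent space is
    -- zero, is treated separately.
    by_cases hne : Nonempty {x : σ.verts // x ≠ ⟨v, hv⟩}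
    · exact basisOfLinearIndependentOfCardEqFinrank hli hcard
    · exact Module.Basis.mk hli (by
        rw [not_nonempty_iff] at hne
        rw [Fintype.card_eq_zero] at hcard
        rw [(Submodule.finrank_eq_zero (S := (⊤ : Submodule ℝ σ.tan))).1 (by
          rw [finrank_top, hcard])]
        exact bot_le)
  have he : ∀ x, e x = σ.edge v x.1 := by
    intro x
    have hne : Nonempty {x : σ.verts // x ≠ ⟨v, hv⟩} := ⟨x⟩
    simp only [e, dif_pos hne]
    simp
  refine Module.Basis.ext_alternating e fun u hu => ?_
  have hinj : Function.Injective fun i => (u i).1.1 := fun i j hij =>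
    hu (Subtype.ext (Subtype.ext hij))
  obtain ⟨π, hπ⟩ := exists_perm_enum hinj
  have hmem : Finset.univ.image (fun i => (u i).1.1) ∈ (σ.verts.erase v).powersetCard ℓ := by
    rw [Finset.mem_powersetCard, Finset.card_image_of_injective _ hinj, Finset.card_univ,
      Fintype.card_fin]
    refine ⟨fun x hx => ?_, rfl⟩
    obtain ⟨i, -, rfl⟩ := Finset.mem_image.1 hx
    exact Finset.mem_erase.2 ⟨fun hc => (u i).2 (Subtype.ext hc), (u i).1.2⟩
  have h0 := h _ hmem
  have h1 : (fun i => e (u i)) =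
      (fun i => σ.edge v (enum ℓ (Finset.univ.image fun i => (u i).1.1) i)) ∘ π := by
    funext i
    rw [he]
    exact congrArg (σ.edge v) (congrFun hπ i)
  rw [h1, AlternatingMap.map_perm, h0, smul_zero, AlternatingMap.zero_apply]

/-- A chosen vertex. -/
def base (τ : Simplex n) : Eucl n := τ.nonempty.choose

theorem base_mem (τ : Simplex n) : τ.base ∈ τ.verts := τ.nonempty.choose_spec

/-- The sets of `ℓ` vertices of `σ` other than the base vertex of `τ` that together with `τ`
span `σ`. -/
def spanSets (ℓ : ℕ) (τ σ : Simplex n) : Finset (Finset (Eucl n)) :=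
  open Classical in {I ∈ (σ.verts.erase τ.base).powersetCard ℓ | I ∪ τ.verts = σ.verts}

end Simplex

/-- Evaluation of alternating forms. -/
def evalAlt {V : Type*} [AddCommGroup V] [Module ℝ V] {ℓ : ℕ} (u : Fin ℓ → V) :
    (V [⋀^Fin ℓ]→ₗ[ℝ] ℝ) →ₗ[ℝ] ℝ where
  toFun η := η u
  map_add' _ _ := rfl
  map_smul' _ _ := rfl

theorem finrank_le_of_separating {M : Type*} [AddCommGroup M] [Module ℝ M] {S : Submodule ℝ M}
    {ι : Type*} [Fintype ι] {N : ι → Type*} [∀ i, AddCommGroup (N i)] [∀ i, Module ℝ (N i)]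
    (B : ∀ i, Submodule ℝ (N i)) [∀ i, Module.Finite ℝ (B i)]
    (Φ : ∀ i, S →ₗ[ℝ] Module.Dual ℝ (B i)) (h : ∀ ω, (∀ i, Φ i ω = 0) → ω = 0) :
    Module.finrank ℝ S ≤ ∑ i, Module.finrank ℝ (B i) := by
  have hinj : Function.Injective (LinearMap.pi Φ) := by
    rw [← LinearMap.ker_eq_bot, LinearMap.ker_eq_bot']
    exact fun ω hω => h ω fun i => congrFun hω i
  calc _ ≤ Module.finrank ℝ (∀ i, Module.Dual ℝ (B i)) :=
        LinearMap.finrank_le_finrank_of_injective hinj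
    _ = ∑ i, Module.finrank ℝ (Module.Dual ℝ (B i)) := Module.finrank_pi_fintype ℝ
    _ = _ := Finset.sum_congr rfl fun i _ => Subspace.dual_finrank_eq

namespace Simplex

variable {n : ℕ} {σ τ : Simplex n} {k ℓ r : ℕ}

/-- A double bubble vanishes if the moments of its components vanish that belong to the faces `τ`
and the sets of vertices that together with `τ` span `σ`. -/
theorem bubble₂_eq_zero {ω : σ.hull → σ.tan [⋀^Fin k]→ₗ[ℝ] (σ.tan [⋀^Fin ℓ]→ₗ[ℝ] ℝ)}
    (hω : ω ∈ σ.bubble₂ r k ℓ)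
    (h : ∀ (τ : Simplex n) (hτ : τ ≤ σ), ∀ I ∈ spanSets ℓ τ σ, ∀ b ∈ τ.bubble r k,
      τ.l2Inner (fun a b : ℝ => a * b)
        (faceTrace hτ (evalAlt fun i => σ.edge τ.base (enum ℓ I i)) ω) b = 0) : ω = 0 := by
  classical
  obtain ⟨hmem, hfacet⟩ := mem_bubble₂_iff.1 hω
  -- Only the first index is restricted to `τ` here; the value remains a full `ℓ`-form on `σ`. The
  -- case `τ = σ` is the claim.
  have key : ∀ (d : ℕ) (τ : Simplex n) (hτ : τ ≤ σ), τ.dim = d →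
      ∀ (x : τ.hull) (v : Fin k → τ.tan),
        ω (Set.inclusion (hull_mono hτ) x) (fun i => tanIncl hτ (v i)) = 0 := by
    intro d
    induction d using Nat.strong_induction_on with
    | _ d ih =>
    intro τ hτ hd x v
    refine alternating_eq_zero (hτ τ.base_mem) _ fun I hI => ?_
    obtain ⟨hIσ, hIcard⟩ := Finset.mem_powersetCard.1 hI
    by_cases hspan : I ∪ τ.verts = σ.verts
    · have hα := faceTrace_mem hτ (evalAlt fun i => σ.edge τ.base (enum ℓ I i)) hmem
      have hbub : faceTrace hτ (evalAlt fun i => σ.edge τ.base (enum ℓ I i)) ω ∈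
          τ.bubble r k := by
        refine mem_bubble_iff.2 ⟨hα, fun F hF hFd => faceTrace_eq_zero_iff.2 fun y u => ?_⟩
        have := ih F.dim (by omega) F (le_trans hF hτ) rfl y u
        exact DFunLike.congr_fun this fun i => σ.edge τ.base (enum ℓ I i)
      have h0 := eq_zero_of_l2Inner_self isInner_mul hα
        (h τ hτ I (Finset.mem_filter.2 ⟨hI, hspan⟩) _ hbub)
      exact faceTrace_eq_zero_iff.1 h0 x v
    · have hsub : I ∪ τ.verts ⊆ σ.verts :=
        Finset.union_subset (hIσ.trans (Finset.erase_subset _ _)) hτ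
      obtain ⟨w, hw, hwn⟩ : ∃ w ∈ σ.verts, w ∉ I ∪ τ.verts :=
        Finset.not_subset.1 fun hc => hspan (Finset.Subset.antisymm hsub hc)
      have hsubw : I ∪ τ.verts ⊆ σ.verts.erase w := fun y hy =>
        Finset.mem_erase.2 ⟨fun hc => hwn (hc ▸ hy), hsub hy⟩
      obtain ⟨F, hF, hFd, hFv⟩ := exists_facet hw
        ⟨τ.base, hsubw (Finset.mem_union_right _ τ.base_mem)⟩
      rw [← hFv] at hsubw
      have hτF : τ ≤ F := fun y hy => hsubw (Finset.mem_union_right _ hy)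
      have h0 := faceTrace_eq_zero_iff.1 (hfacet F hF hFd) (Set.inclusion (hull_mono hτF) x)
        fun i => tanIncl hτF (v i)
      have h1 := DFunLike.congr_fun h0 fun i => F.edge τ.base (enum ℓ I i)
      have h2 : (fun i => σ.edge τ.base (enum ℓ I i)) =
          fun i => tanIncl hF (F.edge τ.base (enum ℓ I i)) := by
        funext i
        have hi := enum_mem hIcard i
        refine Subtype.ext ?_
        rw [coe_edge (hτ τ.base_mem) (hsub (Finset.mem_union_left _ hi))]
        exact (coe_edge (hτF τ.base_mem) (hsubw (Finset.mem_union_left _ hi))).symm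
      rw [h2]
      exact h1
  funext x
  ext v : 1
  exact key _ σ (le_refl σ) rfl x v

theorem exists_faceTrace_bilin {W W' : Type} [AddCommGroup W] [Module ℝ W] [AddCommGroup W']
    [Module ℝ W'] [Module.Finite ℝ W'] (hτ : τ ≤ σ) (L : W →ₗ[ℝ] W') {ip : W' → W' → ℝ}
    (hip : IsInner ip) {S : Submodule ℝ (σ.hull → σ.tan [⋀^Fin k]→ₗ[ℝ] W)}
    (hS : S ≤ prMinus σ.hull W r k) {B : Submodule ℝ (τ.hull → τ.tan [⋀^Fin k]→ₗ[ℝ] W')}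
    (hB : B ≤ prMinus τ.hull W' r k) :
    ∃ Φ : S →ₗ[ℝ] Module.Dual ℝ B, ∀ ω b,
      Φ ω b = τ.l2Inner (k := k) ip (faceTrace hτ L ω) b :=
  exists_bilin_of_mem S hB (faceTrace hτ L) (fun _ hω => faceTrace_mem hτ L (hS hω))
    (τ.l2Inner ip) (fun _ hx _ hy _ hz => l2Inner_add_left hip hx hy hz)
    (fun a _ _ => l2Inner_smul_left hip a)
    (fun _ hx _ hy _ hz => l2Inner_add_right hip hx hy hz)
    (fun a _ _ => l2Inner_smul_right hip a)

theorem finrank_le_of_moments {W : Type} [AddCommGroup W] [Module ℝ W]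
    {S : Submodule ℝ (σ.hull → σ.tan [⋀^Fin k]→ₗ[ℝ] W)} (hS : S ≤ prMinus σ.hull W r k)
    {ι : Type} [Fintype ι] (τ : ι → Simplex n) (hτ : ∀ i, τ i ≤ σ) (L : ι → (W →ₗ[ℝ] ℝ))
    (h : ∀ ω ∈ S, (∀ i, ∀ b ∈ (τ i).bubble r k,
      (τ i).l2Inner (fun a b : ℝ => a * b) (faceTrace (hτ i) (L i) ω) b = 0) → ω = 0) :
    Module.finrank ℝ S ≤ ∑ i, Module.finrank ℝ ((τ i).bubble r k) := by
  choose Φ hΦ using fun i => exists_faceTrace_bilin (hτ i) (L i) isInner_mul hS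
    (bubble_le (σ := τ i))
  refine finrank_le_of_separating (fun i => (τ i).bubble r k) Φ fun ω hω =>
    Subtype.ext (h ω ω.2 fun i b hb => ?_)
  have := hΦ i ω ⟨b, hb⟩
  rw [hω] at this
  exact this.symm

theorem finrank_bubble₂_le :
    Module.finrank ℝ (σ.bubble₂ r k ℓ) ≤ ∑ τ : {τ : Simplex n // τ ≤ σ},
      Module.finrank ℝ (τ.1.bubble r k) * (spanSets ℓ τ σ).card := by
  have := finrank_le_of_moments (bubble₂_le (σ := σ) (r := r) (k := k) (ℓ := ℓ))
    (ι := (τ : {τ : Simplex n // τ ≤ σ}) × spanSets ℓ τ.1 σ) (fun i => i.1.1) (fun i => i.1.2)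
    (fun i => evalAlt fun j => σ.edge i.1.1.base (enum ℓ i.2.1 j))
    fun ω hω h => bubble₂_eq_zero hω fun τ hτ I hI b hb => h ⟨⟨τ, hτ⟩, ⟨I, hI⟩⟩ b hb
  refine this.trans (le_of_eq ?_)
  rw [Fintype.sum_sigma]
  refine Finset.sum_congr rfl fun τ _ => ?_
  refine (Finset.sum_const (Module.finrank ℝ (τ.1.bubble r k))).trans ?_
  rw [Finset.card_univ, Fintype.card_coe, smul_eq_mul, mul_comm]

end Simplex

/-! ### Counting -/

section Counting

/-- The number of sets of `ℓ` elements that have more than `t + ℓ - c` elements among `t` of `n`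
given ones. -/
def lowCount (n ℓ c t : ℕ) : ℕ :=
  ∑ q ∈ (Finset.range (ℓ + 1)).filter fun q => t + ℓ < c + q, t.choose q * (n - t).choose (ℓ - q)

/-- If `I` has `ℓ` elements, `q` of them in `A`, then `I ∪ A` has `A.card + ℓ - q` elements, so the
condition on `q` says that this union has fewer than `c` elements. -/
theorem lowCount_le_card {α : Type*} [DecidableEq α] {A B : Finset α} (hAB : Disjoint A B)
    (ℓ c : ℕ) : lowCount (A.card + B.card) ℓ c A.card ≤
      ((A ∪ B).powersetCard ℓ |>.filter fun I => (I ∪ A).card < c).card := by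
  let Q := (Finset.range (ℓ + 1)).filter fun q => A.card + ℓ < c + q
  have hcard : lowCount (A.card + B.card) ℓ c A.card =
      (Q.sigma fun q => A.powersetCard q ×ˢ B.powersetCard (ℓ - q)).card := by
    rw [Finset.card_sigma, lowCount]
    refine Finset.sum_congr rfl fun q _ => ?_
    rw [Finset.card_product, Finset.card_powersetCard, Finset.card_powersetCard,
      Nat.add_sub_cancel_left]
  have hA : ∀ I J, I ⊆ A → J ⊆ B → (I ∪ J) ∩ A = I := by
    intro I J hI hJ
    rw [Finset.union_inter_distrib_right, Finset.inter_eq_left.2 hI,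
      Finset.disjoint_iff_inter_eq_empty.1 (hAB.symm.mono_left hJ), Finset.union_empty]
  have hB : ∀ I J, I ⊆ A → J ⊆ B → (I ∪ J) ∩ B = J := by
    intro I J hI hJ
    rw [Finset.union_inter_distrib_right, Finset.inter_eq_left.2 hJ,
      Finset.disjoint_iff_inter_eq_empty.1 (hAB.mono_left hI), Finset.empty_union]
  rw [hcard]
  refine Finset.card_le_card_of_injOn (fun x => x.2.1 ∪ x.2.2) ?_ ?_
  · rintro ⟨q, I, J⟩ hx
    simp only [Finset.coe_sigma, Finset.mem_coe, Finset.mem_product,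
      Finset.mem_powersetCard, Set.mem_sigma_iff, Q, Finset.mem_filter, Finset.mem_range] at hx
    obtain ⟨⟨hq, hqc⟩, ⟨hI, hIc⟩, hJ, hJc⟩ := hx
    have hdis : Disjoint I J := hAB.mono hI hJ
    have h1 : I ∪ J ∪ A = A ∪ J := by
      rw [Finset.union_comm I J, Finset.union_assoc, Finset.union_eq_right.2 hI, Finset.union_comm]
    simp only [Finset.mem_coe, Finset.mem_filter, Finset.mem_powersetCard]
    rw [h1, Finset.card_union_of_disjoint (hAB.mono_right hJ), Finset.card_union_of_disjoint hdis]
    exact ⟨⟨Finset.union_subset_union hI hJ, by omega⟩, by omega⟩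
  · rintro ⟨q, I, J⟩ hx ⟨q', I', J'⟩ hx' heq
    simp only [Finset.coe_sigma, Finset.mem_coe, Finset.mem_product,
      Finset.mem_powersetCard, Set.mem_sigma_iff, Q, Finset.mem_filter, Finset.mem_range] at hx hx'
    obtain ⟨-, ⟨hI, hIc⟩, hJ, -⟩ := hx
    obtain ⟨-, ⟨hI', hIc'⟩, hJ', -⟩ := hx'
    simp only at heq
    have e1 : I = I' := by rw [← hA I J hI hJ, heq, hA I' J' hI' hJ']
    have e2 : J = J' := by rw [← hB I J hI hJ, heq, hB I' J' hI' hJ']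
    subst e1 e2
    have : q = q' := by rw [← hIc, hIc']
    subst this
    rfl

variable {n : ℕ} {K τ : Simplex n}

/-- A set `I` of `ℓ` vertices of `K` other than the base of `τ` spans with `τ` exactly one face. It
is counted by `lowCount` if the dimension of that face is below `c`, and otherwise in `spanSets` of
that face only. -/
theorem count_le (hK : K.dim = n) (hτ : τ ≤ K) (ℓ c : ℕ) :
    lowCount n ℓ c τ.dim +
      ∑ σ : {σ : Simplex n // σ ≤ K} with c ≤ σ.1.dim, (Simplex.spanSets ℓ τ σ.1).card ≤
      n.choose ℓ := by
  classical
  have hbase := τ.base_mem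
  have hunion : τ.verts.erase τ.base ∪ (K.verts \ τ.verts) = K.verts.erase τ.base := by
    ext x
    simp only [Finset.mem_union, Finset.mem_erase, Finset.mem_sdiff]
    constructor
    · rintro (⟨h1, h2⟩ | ⟨h1, h2⟩)
      · exact ⟨h1, hτ h2⟩
      · exact ⟨fun h => h2 (h ▸ hbase), h1⟩
    · rintro ⟨h1, h2⟩
      by_cases hx : x ∈ τ.verts
      · exact Or.inl ⟨h1, hx⟩
      · exact Or.inr ⟨h2, hx⟩
  have hdis : Disjoint (τ.verts.erase τ.base) (K.verts \ τ.verts) :=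
    Finset.disjoint_sdiff.mono_left (Finset.erase_subset _ _)
  have hcA : (τ.verts.erase τ.base).card = τ.dim := by
    rw [Finset.card_erase_of_mem hbase, τ.card_verts, Nat.add_sub_cancel]
  have hcK : (K.verts.erase τ.base).card = n := by
    rw [Finset.card_erase_of_mem (hτ hbase), K.card_verts, Nat.add_sub_cancel, hK]
  have hcB : τ.dim + (K.verts \ τ.verts).card = n := by
    rw [← hcA, ← Finset.card_union_of_disjoint hdis, hunion, hcK]
  have hlow := lowCount_le_card hdis ℓ c
  rw [hcA, hcB, hunion] at hlow
  -- The base vertex accounts for the difference between the number of vertices and the dimension of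
  -- the spanned face.
  have hunionτ : ∀ I ∈ (K.verts.erase τ.base).powersetCard ℓ,
      (I ∪ τ.verts).card = (I ∪ τ.verts.erase τ.base).card + 1 := by
    intro I hI
    have hn : τ.base ∉ I ∪ τ.verts.erase τ.base := by
      rw [Finset.mem_union, not_or]
      exact ⟨fun h => (Finset.mem_erase.1 ((Finset.mem_powersetCard.1 hI).1 h)).1 rfl,
        Finset.notMem_erase _ _⟩
    rw [← Finset.card_insert_of_notMem hn, ← Finset.union_insert, Finset.insert_erase hbase]
  have hhigh : ∑ σ : {σ : Simplex n // σ ≤ K} with c ≤ σ.1.dim,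
      (Simplex.spanSets ℓ τ σ.1).card ≤ ((K.verts.erase τ.base).powersetCard ℓ |>.filter
        fun I => ¬ (I ∪ τ.verts.erase τ.base).card < c).card := by
    rw [← Finset.card_biUnion]
    · refine Finset.card_le_card fun I hI => ?_
      obtain ⟨σ, hσ, hI⟩ := Finset.mem_biUnion.1 hI
      obtain ⟨hI1, hI2⟩ := Finset.mem_filter.1 hI
      have hmem : I ∈ (K.verts.erase τ.base).powersetCard ℓ :=
        Finset.powersetCard_mono (Finset.erase_subset_erase _ σ.2) hI1
      refine Finset.mem_filter.2 ⟨hmem, ?_⟩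
      have h1 := hunionτ I hmem
      rw [hI2, σ.1.card_verts] at h1
      have h2 := (Finset.mem_filter.1 hσ).2
      omega
    · intro σ _ σ' _ hne
      rw [Function.onFun, Finset.disjoint_left]
      intro I hI hI'
      exact hne (Subtype.ext (Simplex.ext
        ((Finset.mem_filter.1 hI).2.symm.trans (Finset.mem_filter.1 hI').2)))
  calc _ ≤ _ := Nat.add_le_add hlow hhigh
    _ = ((K.verts.erase τ.base).powersetCard ℓ).card := Finset.card_filter_add_card_filter_not _
    _ = n.choose ℓ := by rw [Finset.card_powersetCard, hcK]

end Counting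

/-! ### Unisolvence for an abstract family of low traces -/

section Unisolvence

variable {n k ℓ r c : ℕ}

theorem finrank_shape_ge (hr : 1 ≤ r) {K : Simplex n} (hK : K.dim = n) :
    (∑ τ : {τ : Simplex n // τ ≤ K}, Module.finrank ℝ (τ.1.bubble r k)) * n.choose ℓ ≤
      Module.finrank ℝ (shape n k ℓ r) := by
  have h1 := sum_finrank_bubble_le (k := k) hr hK
  have h2 := finrank_prMinus_mul_le (Eucl n) (W := Eucl n [⋀^Fin ℓ]→ₗ[ℝ] ℝ) r k
  rw [finrank_alternatingMap, Module.finrank_self, mul_one, finrank_euclideanSpace,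
    Fintype.card_fin] at h2
  exact (Nat.mul_le_mul_right _ h1).trans h2

theorem sum_faces_le {K σ : Simplex n} (hσ : σ ≤ K) (f : Simplex n → ℕ) :
    ∑ τ : {τ : Simplex n // τ ≤ σ}, f τ ≤ ∑ τ : {τ : Simplex n // τ ≤ K}, f τ := by
  let e : {τ : Simplex n // τ ≤ σ} ↪ {τ : Simplex n // τ ≤ K} :=
    ⟨fun τ => ⟨τ.1, Simplex.le_trans τ.2 hσ⟩, fun τ τ' h => Subtype.ext (congrArg (·.1) h)⟩
  calc _ = ∑ τ ∈ Finset.univ.map e, f τ := (Finset.sum_map Finset.univ e fun τ => f τ).symm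
    _ ≤ _ := Finset.sum_le_sum_of_subset (Finset.subset_univ _)

theorem LowTraces.finrank_dofs_le (T : LowTraces n ℓ c)
    (hT : ∀ σ : Simplex n, σ.dim < c → Module.finrank ℝ (T.W σ) ≤ lowCount n ℓ c σ.dim)
    {K σ : Simplex n} (hσ : σ ≤ K) :
    Module.finrank ℝ (T.dofs k r σ).Test ≤
      Module.finrank ℝ (σ.bubble r k) * lowCount n ℓ c σ.dim +
        if c ≤ σ.dim then ∑ τ : {τ : Simplex n // τ ≤ K},
          Module.finrank ℝ (τ.1.bubble r k) * (Simplex.spanSets ℓ τ.1 σ).card else 0 := by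
  rcases lt_or_ge σ.dim c with hc | hc
  · rw [if_neg hc.not_ge, add_zero]
    rcases lt_or_ge σ.dim k with hk | hk
    · rw [dofs_of_lt_of_lt hc hk]
      have : Module.finrank ℝ (Dofs.none (DForm n k ℓ)).Test = 0 :=
        Module.finrank_zero_of_subsingleton (M := PUnit)
      rw [this]
      exact Nat.zero_le _
    · rw [dofs_of_lt hc hk]
      exact Simplex.finrank_bubbleTensor_le.trans (Nat.mul_le_mul_left _ (hT σ hc))
  · rw [if_pos hc, dofs_of_le hc]
    refine le_trans ?_ (Nat.le_add_left _ _)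
    exact Simplex.finrank_bubble₂_le.trans (sum_faces_le hσ fun τ =>
      Module.finrank ℝ (τ.bubble r k) * (Simplex.spanSets ℓ τ σ).card)

/-- After exchanging the sums over `σ` and `τ`, the coefficient of the bubble dimension of `τ` is
the number bounded in `count_le` by `n.choose ℓ`. -/
theorem LowTraces.sum_finrank_dofs_le (T : LowTraces n ℓ c) (hr : 1 ≤ r)
    (hT : ∀ σ : Simplex n, σ.dim < c → Module.finrank ℝ (T.W σ) ≤ lowCount n ℓ c σ.dim)
    {K : Simplex n} (hK : K.dim = n) :
    ∑ σ : {σ : Simplex n // σ ≤ K}, Module.finrank ℝ (T.dofs k r σ).Test ≤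
      Module.finrank ℝ (shape n k ℓ r) := by
  refine le_trans (Finset.sum_le_sum fun σ _ => T.finrank_dofs_le (k := k) (r := r) hT σ.2) ?_
  refine le_trans ?_ ((Finset.sum_mul _ _ _).symm.le.trans (finrank_shape_ge hr hK))
  rw [Finset.sum_add_distrib, ← Finset.sum_filter, Finset.sum_comm, ← Finset.sum_add_distrib]
  refine Finset.sum_le_sum fun τ _ => ?_
  rw [← Finset.mul_sum, ← Nat.mul_add]
  exact Nat.mul_le_mul_left _ (count_le hK τ.2 ℓ c)

theorem LowTraces.unisolvent_of_finrank_le (T : LowTraces n ℓ c) (hr : 1 ≤ r)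
    (hT : ∀ σ : Simplex n, σ.dim < c → Module.finrank ℝ (T.W σ) ≤ lowCount n ℓ c σ.dim)
    {K : Simplex n} (hK : K.dim = n) (hlow : K.dim < c → ∀ η, T.L K η = 0 → η = 0) :
    Unisolvent K (shape n k ℓ r) (T.dofs k r) :=
  T.unisolvent hK hlow (T.sum_finrank_dofs_le hr hT hK)

end Unisolvence

/-! ### Tangential-normal components -/

namespace Simplex

variable {n ℓ p : ℕ} {F σ : Simplex n} {η : Eucl n [⋀^Fin ℓ]→ₗ[ℝ] ℝ}

theorem vartheta_apply (σ : Simplex n) {q : ℕ} (hq : q ≤ ℓ) (η : Eucl n [⋀^Fin ℓ]→ₗ[ℝ] ℝ)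
    (t : Fin q → σ.tan) (u : Fin (ℓ - q) → σ.nor) :
    σ.vartheta ℓ q η t u = η fun i => Fin.append (fun i => (t i : Eucl n)) (fun i => (u i : Eucl n))
      (finCongr (Nat.add_sub_cancel' hq).symm i) := by
  rw [vartheta, dif_pos hq]
  rfl

theorem mem_degs {q : ℕ} : q ∈ σ.degs ℓ p ↔ q ≤ ℓ ∧ q ≤ σ.dim ∧ σ.dim < q + p := by
  simp [degs]

/-- The form `η` vanishes on tangential and normal vectors if more than `dim σ - p` of them are
tangential. -/
def VanishesTangentially (σ : Simplex n) (p : ℕ) (η : Eucl n [⋀^Fin ℓ]→ₗ[ℝ] ℝ) : Prop :=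
  ∀ (w : Fin ℓ → Eucl n) (S : Finset (Fin ℓ)), (∀ i ∈ S, w i ∈ σ.tan) → (∀ i ∉ S, w i ∈ σ.nor) →
    σ.dim < S.card + p → η w = 0

theorem alternating_eq_zero_of_dim_lt_card {V N : Type*} [AddCommGroup V] [Module ℝ V]
    [Module.Finite ℝ V] [AddCommGroup N] [Module ℝ N] (η : V [⋀^Fin ℓ]→ₗ[ℝ] N) {w : Fin ℓ → V}
    {S : Finset (Fin ℓ)} {T : Submodule ℝ V} (hw : ∀ i ∈ S, w i ∈ T)
    (h : Module.finrank ℝ T < S.card) : η w = 0 := by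
  refine AlternatingMap.map_linearDependent η w fun hli => ?_
  have h1 : LinearIndependent ℝ fun i : S => (⟨w i, hw i i.2⟩ : T) :=
    LinearIndependent.of_comp T.subtype (hli.comp ((↑) : S → Fin ℓ) Subtype.val_injective)
  have h2 := h1.fintype_card_le_finrank
  rw [Fintype.card_coe] at h2
  omega

/-- A permutation moves the tangential arguments to the front, where `vartheta` applies. This frees
the trace condition from the order of the slots, as the facet argument requires. -/
theorem vanishesTangentially_of_jmathP (h : σ.jmathP ℓ p η = 0) : σ.VanishesTangentially p η := by
  intro w S hS hSc hlt
  -- More than `σ.dim` tangential arguments are linearly dependent; this degree is not in `degs`.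
  rcases lt_or_ge σ.dim S.card with hd | hd
  · exact alternating_eq_zero_of_dim_lt_card η hS (by rwa [finrank_tan])
  have hq : S.card ≤ ℓ := by simpa using Finset.card_le_univ S
  have hc : Sᶜ.card = ℓ - S.card := by rw [Finset.card_compl, Fintype.card_fin]
  have h0 : σ.vartheta ℓ S.card η = 0 :=
    congrFun h ⟨S.card, mem_degs.2 ⟨hq, hd, hlt⟩⟩
  let e : Fin S.card ⊕ Fin (ℓ - S.card) ≃ Fin ℓ := finSumEquivOfFinset rfl hc
  have he1 : ∀ i, e (Sum.inl i) ∈ S := fun i => by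
    simp [e, finSumEquivOfFinset_inl, Finset.orderEmbOfFin_mem]
  have he2 : ∀ i, e (Sum.inr i) ∉ S := fun i => by
    rw [← Finset.mem_compl]
    simpa only [e, finSumEquivOfFinset_inr] using Finset.orderEmbOfFin_mem _ _ _
  let π : Equiv.Perm (Fin ℓ) :=
    (finCongr (Nat.add_sub_cancel' hq).symm).trans (finSumFinEquiv.symm.trans e)
  have h1 := DFunLike.congr_fun (DFunLike.congr_fun h0
    fun i => ⟨w (e (Sum.inl i)), hS _ (he1 i)⟩) fun i => ⟨w (e (Sum.inr i)), hSc _ (he2 i)⟩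
  rw [vartheta_apply σ hq] at h1
  have h2 : (fun i => Fin.append (fun i => w (e (Sum.inl i))) (fun i => w (e (Sum.inr i)))
      (finCongr (Nat.add_sub_cancel' hq).symm i)) = w ∘ π := by
    funext i
    change _ = w (e (finSumFinEquiv.symm (finCongr (Nat.add_sub_cancel' hq).symm i)))
    generalize finCongr (Nat.add_sub_cancel' hq).symm i = j
    refine Fin.addCases (fun j => ?_) (fun j => ?_) j <;> simp
  change η (fun i => Fin.append (fun i => w (e (Sum.inl i))) (fun i => w (e (Sum.inr i)))
      (finCongr (Nat.add_sub_cancel' hq).symm i)) = 0 at h1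
  rw [h2, AlternatingMap.map_perm] at h1
  exact (smul_eq_zero_iff_eq _).1 h1

theorem jmathP_of_vanishesTangentially (h : σ.VanishesTangentially p η) : σ.jmathP ℓ p η = 0 := by
  funext ⟨q, hq⟩
  obtain ⟨hqℓ, -, hlt⟩ := mem_degs.1 hq
  change σ.vartheta ℓ q η = 0
  ext t u
  rw [vartheta_apply σ hqℓ]
  have hmem : ∀ i : Fin ℓ, i ∈ Finset.univ.filter (fun i : Fin ℓ => (i : ℕ) < q) ↔ (i : ℕ) < q :=
    fun i => by simp
  have key : ∀ j : Fin (q + (ℓ - q)),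
      ((j : ℕ) < q → Fin.append (fun i => (t i : Eucl n)) (fun i => (u i : Eucl n)) j ∈ σ.tan) ∧
      (¬ (j : ℕ) < q → Fin.append (fun i => (t i : Eucl n)) (fun i => (u i : Eucl n)) j ∈ σ.nor) :=
    fun j => by refine Fin.addCases (fun j => ?_) (fun j => ?_) j <;> simp
  refine h _ (Finset.univ.filter fun i : Fin ℓ => (i : ℕ) < q)
    (fun i hi => (key _).1 ((hmem i).1 hi)) (fun i hi => (key _).2 fun hc => hi ((hmem i).2 hc)) ?_
  have hcard : (Finset.univ.filter fun i : Fin ℓ => (i : ℕ) < q).card = q := by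
    rw [Fin.card_filter_val_lt, min_eq_right hqℓ]
  rwa [hcard]

/-- On a facet there is one tangential direction less. -/
theorem VanishesTangentially.of_facet (hF : F ≤ σ) (hd : F.dim + 1 = σ.dim)
    (h : F.VanishesTangentially p η) : σ.VanishesTangentially p η := by
  intro w S hS hSc hlt
  have hle : F.tan ≤ σ.tan := AffineSubspace.direction_le (hull_mono hF)
  have hnor : σ.nor ≤ F.nor := Submodule.orthogonal_le hle
  -- The tangent space of `σ` exceeds that of `F` by a single line normal to `F`.
  have hfin : Module.finrank ℝ (F.nor ⊓ σ.tan : Submodule ℝ (Eucl n)) = 1 := by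
    have : Module.finrank ℝ F.tan + Module.finrank ℝ (F.nor ⊓ σ.tan : Submodule ℝ (Eucl n)) =
        Module.finrank ℝ σ.tan := Submodule.finrank_add_inf_finrank_orthogonal hle
    rw [finrank_tan, finrank_tan] at this
    omega
  let P := F.tan.starProjection
  have hP : ∀ z, P z ∈ F.tan := fun z => Submodule.starProjection_apply_mem _ z
  have hP' : ∀ z, z - P z ∈ F.nor := fun z => Submodule.sub_starProjection_mem_orthogonal z
  let m : Fin ℓ → Eucl n := fun i => if i ∈ S then P (w i) else w i
  let m' : Fin ℓ → Eucl n := fun i => if i ∈ S then w i - P (w i) else 0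
  have hw : w = m + m' := by
    funext i
    by_cases hi : i ∈ S <;> simp [m, m', hi]
  -- Each argument tangential to `σ` is split into its part along `F` and its part on the normal
  -- line; in the expansion `sᶜ` is the set of slots taking the second part.
  have hsum := η.toMultilinearMap.map_add_univ m m'
  rw [← hw] at hsum
  refine hsum.trans (Finset.sum_eq_zero fun s _ => ?_)
  change η (s.piecewise m m') = 0
  by_cases hsub : sᶜ ⊆ S
  · have hm' : ∀ i ∈ sᶜ, s.piecewise m m' i = w i - P (w i) := fun i hi => by
      rw [Finset.piecewise_eq_of_notMem _ _ _ (Finset.mem_compl.1 hi)]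
      simp [m', hsub hi]
    rcases lt_or_ge 1 sᶜ.card with hcard | hcard
    · refine alternating_eq_zero_of_dim_lt_card η (S := sᶜ) (T := F.nor ⊓ σ.tan)
        (fun i hi => ?_) (hfin ▸ hcard)
      rw [hm' i hi]
      exact ⟨hP' _, σ.tan.sub_mem (hS i (hsub hi)) (hle (hP _))⟩
    -- At most one argument is lost from the tangential ones, while the dimension drops by one, so
    -- the inequality for `σ` gives the one for `F`.
    · refine h _ (S \ sᶜ) (fun i hi => ?_) (fun i hi => ?_) ?_
      · obtain ⟨hi1, hi2⟩ := Finset.mem_sdiff.1 hi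
        rw [Finset.mem_compl, not_not] at hi2
        rw [Finset.piecewise_eq_of_mem _ _ _ hi2]
        simpa [m, hi1] using hP (w i)
      · by_cases hi1 : i ∈ sᶜ
        · rw [hm' i hi1]
          exact hP' _
        · have hi2 : i ∉ S := fun hc => hi (Finset.mem_sdiff.2 ⟨hc, hi1⟩)
          rw [Finset.mem_compl, not_not] at hi1
          rw [Finset.piecewise_eq_of_mem _ _ _ hi1]
          simpa [m, hi2] using hnor (hSc i hi2)
      · rw [Finset.card_sdiff_of_subset hsub]
        omega
  · obtain ⟨i, hi, hiS⟩ := Finset.not_subset.1 hsub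
    refine η.map_coord_zero i ?_
    rw [Finset.piecewise_eq_of_notMem _ _ _ (Finset.mem_compl.1 hi)]
    simp [m', hiS]

theorem VanishesTangentially.iota_eq_zero (h : σ.VanishesTangentially p η) (hd : σ.dim < ℓ + p) :
    σ.iota ℓ η = 0 := by
  ext v
  exact h (fun i => v i) Finset.univ (fun i _ => (v i).2)
    (fun i hi => absurd (Finset.mem_univ i) hi) (by simpa using hd)

theorem VanishesTangentially.eq_zero (h : σ.VanishesTangentially p η) (hd : σ.dim < ℓ + p)
    (hσ : σ.dim = n) : η = 0 := by
  ext v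
  refine h v Finset.univ (fun i _ => ?_) (fun i hi => absurd (Finset.mem_univ i) hi)
    (by simpa using hd)
  rw [tan, hull_eq_top hσ, AffineSubspace.direction_top]
  trivial

/-- For `p = 1` the only admissible tangential degree is `σ.dim`, and beyond `ℓ` both traces are
zero. -/
theorem jmath_eq_zero_iff : σ.jmath ℓ η = 0 ↔ σ.jmathP ℓ 1 η = 0 := by
  constructor
  · intro h
    funext ⟨q, hq⟩
    obtain ⟨-, h1, h2⟩ := mem_degs.1 hq
    obtain rfl : q = σ.dim := by omega
    exact h
  · intro h
    rcases le_or_gt σ.dim ℓ with hd | hd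
    · exact congrFun h ⟨σ.dim, mem_degs.2 ⟨hd, le_rfl, by omega⟩⟩
    · rw [jmath, vartheta, dif_neg hd.not_ge]
      rfl

theorem finrank_nor (σ : Simplex n) : Module.finrank ℝ σ.nor = n - σ.dim := by
  have : Module.finrank ℝ σ.tan + Module.finrank ℝ σ.nor = Module.finrank ℝ (Eucl n) :=
    Submodule.finrank_add_finrank_orthogonal σ.tan
  rw [finrank_tan, finrank_euclideanSpace, Fintype.card_fin] at this
  omega

theorem finrank_tanNor (σ : Simplex n) (ℓ q : ℕ) : Module.finrank ℝ (σ.TanNor ℓ q) =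
    σ.dim.choose q * (n - σ.dim).choose (ℓ - q) := by
  rw [finrank_alternatingMap, finrank_alternatingMap, finrank_tan, finrank_nor,
    Module.finrank_self, mul_one]

end Simplex

/-- The traces `j_{σ,[p]}^*`. -/
def tanNorSumTraces (n ℓ p : ℕ) : LowTraces n ℓ (ℓ + p) where
  W σ := σ.TanNorSum ℓ p
  ip σ := σ.ipTanNorSum
  L σ := σ.jmathP ℓ p
  isInner σ := σ.ipTanNorSum_isInner
  facet _ _ hF hd _ _ h := Simplex.jmathP_of_vanishesTangentially
    ((Simplex.vanishesTangentially_of_jmathP h).of_facet hF hd)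
  top _ hd _ h := (Simplex.vanishesTangentially_of_jmathP h).iota_eq_zero (by omega)

/-- The traces `j_σ^*`. -/
def tanNorTraces (n ℓ : ℕ) : LowTraces n ℓ (ℓ + 1) where
  W σ := σ.TanNor ℓ σ.dim
  ip σ := σ.ipTanNor
  L σ := σ.jmath ℓ
  isInner σ := σ.ipTanNor_isInner
  facet F σ hF hd hc η h := Simplex.jmath_eq_zero_iff.2
    ((tanNorSumTraces n ℓ 1).facet F σ hF hd hc η (Simplex.jmath_eq_zero_iff.1 h))
  top F hd η h := (tanNorSumTraces n ℓ 1).top F hd η (Simplex.jmath_eq_zero_iff.1 h)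

/-- No traces in low dimensions. -/
def noTraces (n ℓ : ℕ) : LowTraces n ℓ 0 where
  W _ := PUnit
  ip _ _ _ := 0
  L _ := 0
  isInner _ := ⟨⟨0, fun _ _ => rfl⟩, fun _ => le_rfl, fun _ _ => rfl⟩
  facet _ _ _ _ h := absurd h (Nat.not_lt_zero _)
  top _ h := absurd h (Nat.succ_ne_zero _)

theorem noTraces_dofs (n k ℓ r : ℕ) : (noTraces n ℓ).dofs k r = dofsII n k ℓ r :=
  funext fun _ => if_pos (Nat.zero_le _)

theorem tanNorTraces_dofs (n k ℓ r : ℕ) : (tanNorTraces n ℓ).dofs k r = dofsIJ n k ℓ r := rfl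

theorem tanNorSumTraces_dofs (n k ℓ r p : ℕ) :
    (tanNorSumTraces n ℓ p).dofs k r = dofsIJP n k ℓ r p := rfl

/-- With `c = ℓ + 1` the dimension of the value space is the term `q = σ.dim` of `lowCount`. -/
theorem finrank_tanNor_le {n ℓ : ℕ} (σ : Simplex n) (h : σ.dim < ℓ + 1) :
    Module.finrank ℝ (σ.TanNor ℓ σ.dim) ≤ lowCount n ℓ (ℓ + 1) σ.dim := by
  rw [σ.finrank_tanNor]
  exact Finset.single_le_sum
    (f := fun q => σ.dim.choose q * (n - σ.dim).choose (ℓ - q)) (fun _ _ => Nat.zero_le _)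
    (Finset.mem_filter.2 ⟨Finset.mem_range.2 h, by omega⟩)

theorem finrank_tanNorSum_le {n ℓ p : ℕ} (σ : Simplex n) :
    Module.finrank ℝ (σ.TanNorSum ℓ p) ≤ lowCount n ℓ (ℓ + p) σ.dim := by
  have hfree (q : σ.degs ℓ p) : Module.Free ℝ (σ.TanNor ℓ q) := free_alternatingMap q
  have h : Module.finrank ℝ (σ.TanNorSum ℓ p) =
      ∑ q : σ.degs ℓ p, Module.finrank ℝ (σ.TanNor ℓ q) := Module.finrank_pi_fintype ℝ
  simp only [h, Simplex.finrank_tanNor]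
  rw [Finset.sum_coe_sort (σ.degs ℓ p) fun q => σ.dim.choose q * (n - σ.dim).choose (ℓ - q)]
  refine Finset.sum_le_sum_of_subset fun q hq => ?_
  obtain ⟨h1, h2, h3⟩ := Simplex.mem_degs.1 hq
  exact Finset.mem_filter.2 ⟨Finset.mem_range.2 (by omega), by omega⟩

theorem SingleValued.of_ker_le {n k ℓ : ℕ} {𝒯 : Geometry.SimplicialComplex ℝ (Eucl n)}
    {ω : Cell 𝒯 → DForm n k ℓ} {σ : Simplex n} {W W' : Type} [AddCommGroup W] [Module ℝ W]
    [AddCommGroup W'] [Module ℝ W'] {L : (Eucl n [⋀^Fin ℓ]→ₗ[ℝ] ℝ) →ₗ[ℝ] W}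
    {L' : (Eucl n [⋀^Fin ℓ]→ₗ[ℝ] ℝ) →ₗ[ℝ] W'} (hL : ∀ η, L η = 0 → L' η = 0)
    (h : SingleValued ω σ W L) : SingleValued ω σ W' L' := by
  intro K K' hK hK'
  refine trace_eq_of_add_neg_smul (Simplex.trace_eq_zero_iff.2 fun x v => hL _ ?_)
  refine Simplex.trace_eq_zero_iff.1 (?_ : σ.trace L (ω K + (-1 : ℝ) • ω K') = 0) x v
  rw [map_add, map_smul, h K K' hK hK', neg_one_smul, add_neg_cancel]

end FormValued
end

theorem mainTheorem10 (n k ℓ r : ℕ) (hr : 1 ≤ r) :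
    ((∀ K : Simplex n, K.dim = n → Unisolvent K (shape n k ℓ r) (dofsII n k ℓ r)) ∧
      ∀ 𝒯 : Geometry.SimplicialComplex ℝ (Eucl n),
        ConformingII (feSpace 𝒯 (shape n k ℓ r) (dofsII n k ℓ r))) ∧
    (k ≤ ℓ →
      (∀ K : Simplex n, K.dim = n → Unisolvent K (shape n k ℓ r) (dofsIJ n k ℓ r)) ∧
      ∀ 𝒯 : Geometry.SimplicialComplex ℝ (Eucl n),
        ConformingIJ (feSpace 𝒯 (shape n k ℓ r) (dofsIJ n k ℓ r))) ∧
    (∀ p : ℕ, 1 ≤ p → k ≤ ℓ + p - 1 →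
      (∀ K : Simplex n, K.dim = n → Unisolvent K (shape n k ℓ r) (dofsIJP n k ℓ r p)) ∧
      ∀ 𝒯 : Geometry.SimplicialComplex ℝ (Eucl n),
        ConformingIJP p (feSpace 𝒯 (shape n k ℓ r) (dofsIJP n k ℓ r p))) := by
  refine ⟨⟨fun K hK => ?_, fun 𝒯 ω hω σ => ?_⟩, fun _ => ⟨fun K hK => ?_, fun 𝒯 ω hω σ => ?_⟩,
    fun p hp _ => ⟨fun K hK => ?_, fun 𝒯 ω hω σ => ?_⟩⟩
  · rw [← noTraces_dofs]
    exact (noTraces n ℓ).unisolvent_of_finrank_le hr (fun _ h => absurd h (Nat.not_lt_zero _)) hK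
      fun h => absurd h (Nat.not_lt_zero _)
  · rw [← noTraces_dofs] at hω
    exact ((noTraces n ℓ).singleValued hω σ).2 (Nat.zero_le _)
  · rw [← tanNorTraces_dofs]
    exact (tanNorTraces n ℓ).unisolvent_of_finrank_le hr finrank_tanNor_le hK fun hc η h =>
      (Simplex.vanishesTangentially_of_jmathP (Simplex.jmath_eq_zero_iff.1 h)).eq_zero hc hK
  · rw [← tanNorTraces_dofs] at hω
    have hT := (tanNorTraces n ℓ).singleValued hω σ
    refine ⟨fun hd => hT.1 (Nat.lt_succ_of_le hd), fun hd => ?_⟩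
    -- In dimension exactly `ℓ` the degrees of freedom use `jmath`, and single-valuedness of the
    -- pullback follows because `jmath` determines it there.
    rcases hd.eq_or_lt with heq | hlt
    · exact (hT.1 (by omega)).of_ker_le fun η h => (tanNorTraces n ℓ).top σ (by omega) η h
    · exact hT.2 hlt
  · rw [← tanNorSumTraces_dofs]
    exact (tanNorSumTraces n ℓ p).unisolvent_of_finrank_le hr
      (fun σ _ => finrank_tanNorSum_le σ) hK fun hc η h =>
        (Simplex.vanishesTangentially_of_jmathP h).eq_zero hc hK
  · rw [← tanNorSumTraces_dofs] at hω
    have hT := (tanNorSumTraces n ℓ p).singleValued hω σ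
    exact ⟨fun hd => hT.1 (by omega), hT.2⟩
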